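/- Let $\rho_{11},\rho_{12},\rho_{22},\mu,\lambda,q,r:\mathbb R^3\to\mathbb R$ be $C^1$ functions which are bounded from below by a constant $c>0$ and have bounded derivatives, and assume that $\rho:=\rho_{11}\rho_{22}-\rho_{12}^2>0$ and $\lambda r-q^2>0$ at every point of $\mathbb R^3$. Write $\mathbf u=(\mathbf{u^s},\mathbf{u^f})$ with $\mathbf{u^s},\mathbf{u^f}:\mathbb R\times\mathbb R^3\to\mathbb R^3$, and consider Biot's equations without attenuation, $M\partial_t^2\mathbf u+P(D)\mathbf u=\mathbf 0$ in $\mathbb R\times\mathbb R^3$, that is, $$\rho_{11}\partial_t^2\mathbf{u^s}+\rho_{12}\partial_t^2\mathbf{u^f}-\operatorname{div}\tau=0,\qquad \rho_{12}\partial_t^2\mathbf{u^s}+\rho_{22}\partial_t^2\mathbf{u^f}+\nabla p=0,$$ where $\tau=(\lambda\operatorname{div}\mathbf{u^s}+q\operatorname{div}\mathbf{u^f})I_3+\mu(\nabla\mathbf{u^s}+(\nabla\mathbf{u^s})^T)$ and $-p=q\operatorname{div}\mathbf{u^s}+r\operatorname{div}\mathbf{u^f}$. Definition of $c_{max}$.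 Let $a_1(x),a_2(x)$ be the eigenvalues of $$A(x)=\frac1\rho\begin{pmatrix}\rho_{22}&-\rho_{12}\\-\rho_{12}&\rho_{11}\end{pmatrix}\begin{pmatrix}2\mu+\lambda&q\\q&r\end{pmatrix}$$ and let $\mu_1=\rho^{-1}\rho_{22}\mu$. For $a>0$ let $B_0(a)=\mathrm{Diag}(1,a,a,a,a)$, and for $j=1,2,3$ let $B_j(a)$ be the $5\times5$ matrix whose $(1,j+1)$ and $(j+1,1)$ entries are $-a$ and whose other entries are $0$. For $j=0,\dots,3$ let $A_j(x)$ be the $40\times40$ block diagonal matrix with the eight blocks $B_j(a_1(x)),B_j(a_2(x)),B_j(\mu_1(x)),\dots,B_j(\mu_1(x))$. Put $$\Lambda(\xi)=\inf\Big\{\ell\in\mathbb R:\ A_0(x)^{-1/2}\Big(\sum_{j=1}^3\xi_jA_j(x)\Big)A_0(x)^{-1/2}\le\ell I\ \text{ for all }x\in\mathbb R^3\Big\},\qquad c_{max}=\max_{|\xi|=1}\Lambda(\xi),$$ with $\inf\emptyset=+\infty$. Let $\mathbf u$ be a weak solution with locally finite energy: $\mathbf u\in C^1(\mathbb R;L^2_{loc}(\mathbb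 R^3))$, $\nabla\mathbf{u^s}\in C(\mathbb R;L^2_{loc})$, $\operatorname{div}\mathbf{u^f}\in C(\mathbb R;L^2_{loc})$, and the equations hold in the sense of distributions on $\mathbb R\times\mathbb R^3$. Let $R\in\mathbb R$. If $$\operatorname{supp}\big(\mathbf{u^s}(0,\cdot),\operatorname{div}\mathbf{u^f}(0,\cdot)\big)\subset\{|x|\le R\}\quad\text{and}\quad\operatorname{supp}\big(\partial_t\mathbf{u^s}(0,\cdot),\operatorname{div}\partial_t\mathbf{u^f}(0,\cdot)\big)\subset\{|x|\le R\}$$ (the second condition holds in particular if $\partial_t\mathbf u|_{t=0}=\mathbf 0$), then for every $t\in\mathbb R$ $$\operatorname{supp}\big(\mathbf{u^s}(t,\cdot),\operatorname{div}\mathbf{u^f}(t,\cdot)\big)\subset\{x\in\mathbb R^3:\ |x|\le R+c_{max}|t|\}.$$ -/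

import Mathlib

open MeasureTheory Filter Topology
open scoped ContDiff

namespace Biot

noncomputable section

/-- Physical space `ℝ³` with the Euclidean norm. -/
abbrev E3 := EuclideanSpace ℝ (Fin 3)

/-- The `i`-th standard basis vector of `ℝ³`. -/
def e (i : Fin 3) : E3 := EuclideanSpace.single i (1 : ℝ)

/-! ### The coefficients -/

/-- The coefficient functions of the Biot equations. -/
structure Coeffs where
  rho11 : E3 → ℝ
  rho12 : E3 → ℝ
  rho22 : E3 → ℝ
  mu : E3 → ℝ
  lam : E3 → ℝ
  q : E3 → ℝ
  r : E3 → ℝ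

/-- `f` is bounded from below by the constant `c` and has a bounded continuous derivative. -/
structure NiceCoeff (c : ℝ) (f : E3 → ℝ) : Prop where
  lower : ∀ x, c ≤ f x
  contDiff : ContDiff ℝ 1 f
  bounded_deriv : ∃ B : ℝ, ∀ x, ‖fderiv ℝ f x‖ ≤ B

namespace Coeffs

variable (C : Coeffs)

/-- All coefficients are bounded from below by one positive constant and have bounded
derivatives, the mass matrix is positive definite at every point, and `lam * r - q ^ 2 > 0` at
every point. -/
structure Admissible : Prop where
  nice : ∃ c : ℝ, 0 < c ∧ NiceCoeff c C.rho11 ∧ NiceCoeff c C.rho12 ∧ NiceCoeff c C.rho22 ∧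
    NiceCoeff c C.mu ∧ NiceCoeff c C.lam ∧ NiceCoeff c C.q ∧ NiceCoeff c C.r
  mass_pos : ∀ x, 0 < C.rho11 x * C.rho22 x - C.rho12 x ^ 2
  moduli_pos : ∀ x, 0 < C.lam x * C.r x - C.q x ^ 2

/-! ### The symmetric hyperbolic system and the maximal speed -/

/-- `ρ = ρ₁₁ ρ₂₂ - ρ₁₂²`. -/
def rho (x : E3) : ℝ := C.rho11 x * C.rho22 x - C.rho12 x ^ 2

/-- The `2 × 2` coefficient matrix `A(x)` of the system of wave equations satisfied, up to terms
of lower order, by `(div u^s, div u^f)`. -/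
def matA (x : E3) : Matrix (Fin 2) (Fin 2) ℝ :=
  (1 / C.rho x) • (!![C.rho22 x, -C.rho12 x; -C.rho12 x, C.rho11 x] *
    !![2 * C.mu x + C.lam x, C.q x; C.q x, C.r x])

/-- The larger eigenvalue of `A(x)`. -/
def a1 (x : E3) : ℝ :=
  ((C.matA x).trace + √((C.matA x).trace ^ 2 - 4 * (C.matA x).det)) / 2

/-- The smaller eigenvalue of `A(x)`. -/
def a2 (x : E3) : ℝ :=
  ((C.matA x).trace - √((C.matA x).trace ^ 2 - 4 * (C.matA x).det)) / 2

/-- `μ₁ = ρ⁻¹ ρ₂₂ μ`. -/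
def mu1 (x : E3) : ℝ := (C.rho x)⁻¹ * C.rho22 x * C.mu x

/-- The coefficients of the eight scalar wave equations for the two components of
`Q⁻¹ (div u^s, div u^f)`, the three of `u^s` and the three of `curl u^s`. -/
def waveCoeff (x : E3) : Fin 8 → ℝ :=
  ![C.a1 x, C.a2 x, C.mu1 x, C.mu1 x, C.mu1 x, C.mu1 x, C.mu1 x, C.mu1 x]

end Coeffs

/-- `B₀ = Diag(1, a, a, a, a)`, for the unknown `(∂_t v, ∂₁ v, ∂₂ v, ∂₃ v, v)` of a scalar wave
equation `∂_t² v - a Δ v = (lower order)`. -/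
def waveB0 (a : ℝ) : Matrix (Fin 5) (Fin 5) ℝ := Matrix.diagonal ![1, a, a, a, a]

/-- `B₀ ^ (-1/2)`. -/
def waveB0InvSqrt (a : ℝ) : Matrix (Fin 5) (Fin 5) ℝ :=
  Matrix.diagonal ![1, 1 / √a, 1 / √a, 1 / √a, 1 / √a]

/-- The matrix in front of `∂_j` for the same equation. -/
def waveB (j : Fin 3) (a : ℝ) : Matrix (Fin 5) (Fin 5) ℝ :=
  Matrix.of fun k l =>
    if (k = 0 ∧ l = j.succ.castSucc) ∨ (k = j.succ.castSucc ∧ l = 0) then -a else 0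

namespace Coeffs

variable (C : Coeffs)

/-- The `40 × 40` matrix in front of `∂_t` in the symmetric hyperbolic form of the Biot
equations: eight diagonal blocks of size `5`. -/
def sysA0 (x : E3) : Matrix (Fin 5 × Fin 8) (Fin 5 × Fin 8) ℝ :=
  Matrix.blockDiagonal fun k => waveB0 (C.waveCoeff x k)

/-- `A₀(x) ^ (-1/2)`. -/
def sysA0InvSqrt (x : E3) : Matrix (Fin 5 × Fin 8) (Fin 5 × Fin 8) ℝ :=
  Matrix.blockDiagonal fun k => waveB0InvSqrt (C.waveCoeff x k)

/-- The `40 × 40` matrix in front of `∂_j`. -/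
def sysA (j : Fin 3) (x : E3) : Matrix (Fin 5 × Fin 8) (Fin 5 × Fin 8) ℝ :=
  Matrix.blockDiagonal fun k => waveB j (C.waveCoeff x k)

/-- `Λ(ξ)`: the infimum of the real numbers `ℓ` with
`A₀(x)^(-1/2) (∑ⱼ ξⱼ Aⱼ(x)) A₀(x)^(-1/2) ≤ ℓ I` for all `x`, in the order of quadratic forms.
It is `⊤` when there is no such `ℓ`. -/
def Lambda (ξ : E3) : EReal :=
  sInf ((fun l : ℝ => (l : EReal)) '' {l : ℝ | ∀ x : E3,
    (l • (1 : Matrix (Fin 5 × Fin 8) (Fin 5 × Fin 8) ℝ) -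
      C.sysA0InvSqrt x * (∑ j : Fin 3, ξ j • C.sysA j x) * C.sysA0InvSqrt x).PosSemidef})

/-- `c_max`, the maximum of `Λ` over the unit sphere. -/
def cmax : EReal := ⨆ ξ ∈ Metric.sphere (0 : E3) 1, C.Lambda ξ

variable {C}

/-- `A(x)` has real eigenvalues. -/
theorem Admissible.disc_nonneg (h : C.Admissible) (x : E3) :
    0 ≤ (C.matA x).trace ^ 2 - 4 * (C.matA x).det := by
  obtain ⟨c, hc, h11, -, h22, -⟩ := h.nice
  have m1 : 0 < C.rho11 x := lt_of_lt_of_le hc (h11.lower x)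
  have m2 : 0 < C.rho22 x := lt_of_lt_of_le hc (h22.lower x)
  have hρ : 0 < C.rho x := h.mass_pos x
  have hd : C.rho11 x * C.rho22 x - C.rho12 x ^ 2 = C.rho x := rfl
  have key : (C.matA x).trace ^ 2 - 4 * (C.matA x).det =
      (C.rho x * (C.rho22 x * (2 * C.mu x + C.lam x) - C.rho11 x * C.r x) ^ 2 +
        (C.rho11 x * (C.rho22 x * C.q x - C.rho12 x * C.r x) +
          C.rho22 x * (C.rho11 x * C.q x - C.rho12 x * (2 * C.mu x + C.lam x))) ^ 2) /
        (C.rho11 x * C.rho22 x * C.rho x ^ 2) := by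
    rw [eq_div_iff (by positivity)]
    simp only [matA, Matrix.trace_fin_two, Matrix.det_fin_two, Matrix.smul_apply, smul_eq_mul,
      Matrix.mul_apply, Fin.sum_univ_two, Matrix.of_apply, Matrix.cons_val', Matrix.cons_val_zero,
      Matrix.cons_val_one, Matrix.cons_val_fin_one]
    field_simp
    rw [← hd]
    ring
  rw [key]
  positivity

/-- `a1` and `a2` are the two eigenvalues of `A(x)`, with multiplicity. -/
theorem Admissible.charpoly_matA (h : C.Admissible) (x : E3) :
    (C.matA x).charpoly =
      (Polynomial.X - Polynomial.C (C.a1 x)) * (Polynomial.X - Polynomial.C (C.a2 x)) := by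
  have hs := Real.sq_sqrt (h.disc_nonneg x)
  have hsum : (C.matA x).trace = C.a1 x + C.a2 x := by simp only [a1, a2]; ring
  have hprod : (C.matA x).det = C.a1 x * C.a2 x := by simp only [a1, a2]; nlinarith
  rw [Matrix.charpoly_fin_two, hsum, hprod, map_add, map_mul]
  ring

/-- Every coefficient of the wave system is positive. -/
theorem Admissible.waveCoeff_pos (h : C.Admissible) (x : E3) (k : Fin 8) :
    0 < C.waveCoeff x k := by
  obtain ⟨c, hc, h11, h12, h22, hmu, hlam, hq, hr⟩ := h.nice
  have m1 : 0 < C.rho11 x := lt_of_lt_of_le hc (h11.lower x)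
  have m2 : 0 < C.rho22 x := lt_of_lt_of_le hc (h22.lower x)
  have p1 : 0 < C.mu x := lt_of_lt_of_le hc (hmu.lower x)
  have p2 : 0 < C.lam x := lt_of_lt_of_le hc (hlam.lower x)
  have p3 : 0 < C.r x := lt_of_lt_of_le hc (hr.lower x)
  have hρ : 0 < C.rho x := h.mass_pos x
  have hm := h.mass_pos x
  have hn := h.moduli_pos x
  have hdet : 0 < (C.matA x).det := by
    have : (C.matA x).det =
        ((C.lam x * C.r x - C.q x ^ 2) + 2 * (C.mu x * C.r x)) / C.rho x := by
      rw [eq_div_iff hρ.ne']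
      simp only [matA, Matrix.det_smul, Matrix.det_mul, Matrix.det_fin_two_of, Fintype.card_fin]
      field_simp
      simp only [rho]
      ring
    rw [this]
    positivity
  have htr : 0 < (C.matA x).trace := by
    have e1 : (C.matA x).trace = (C.rho22 x * (2 * C.mu x + C.lam x) -
        2 * (C.rho12 x * C.q x) + C.rho11 x * C.r x) / C.rho x := by
      rw [eq_div_iff hρ.ne']
      simp only [matA, Matrix.trace_fin_two, Matrix.smul_apply, smul_eq_mul,
        Matrix.mul_apply, Fin.sum_univ_two, Matrix.of_apply, Matrix.cons_val',
        Matrix.cons_val_zero, Matrix.cons_val_one, Matrix.cons_val_fin_one]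
      field_simp
      ring
    rw [e1]
    refine div_pos ?_ hρ
    have h1 : (C.rho12 x * C.q x) ^ 2 < (C.rho11 x * C.rho22 x) * (C.lam x * C.r x) := by
      have a := mul_pos hm (mul_pos p2 p3)
      have b := mul_nonneg (sq_nonneg (C.rho12 x)) hn.le
      nlinarith
    have h2 : 2 * (C.rho12 x * C.q x) < C.rho22 x * C.lam x + C.rho11 x * C.r x := by
      have hpos : 0 < C.rho22 x * C.lam x + C.rho11 x * C.r x := by positivity
      refine lt_of_pow_lt_pow_left₀ 2 hpos.le ?_
      nlinarith [sq_nonneg (C.rho22 x * C.lam x - C.rho11 x * C.r x)]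
    nlinarith [mul_pos m2 p1]
  have hlt : √((C.matA x).trace ^ 2 - 4 * (C.matA x).det) < (C.matA x).trace := by
    rw [Real.sqrt_lt' htr]
    linarith
  have ha2 : 0 < C.a2 x := by simp only [a2]; linarith
  have ha1 : 0 < C.a1 x := by
    simp only [a1]
    have := Real.sqrt_nonneg ((C.matA x).trace ^ 2 - 4 * (C.matA x).det)
    linarith
  have hmu1 : 0 < C.mu1 x := by simp only [mu1]; positivity
  fin_cases k <;> simpa [waveCoeff]

/-- `sysA0InvSqrt` is the inverse square root of `sysA0`. -/
theorem Admissible.sysA0InvSqrt_spec (h : C.Admissible) (x : E3) :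
    C.sysA0InvSqrt x * C.sysA0InvSqrt x * C.sysA0 x = 1 := by
  have hk : ∀ k, waveB0InvSqrt (C.waveCoeff x k) * waveB0InvSqrt (C.waveCoeff x k) *
      waveB0 (C.waveCoeff x k) = 1 := by
    intro k
    have hp := h.waveCoeff_pos x k
    have h1 : 1 / √(C.waveCoeff x k) * (1 / √(C.waveCoeff x k)) * C.waveCoeff x k = 1 := by
      have hs : √(C.waveCoeff x k) ≠ 0 := (Real.sqrt_pos.2 hp).ne'
      have := Real.mul_self_sqrt hp.le
      field_simp
      nlinarith
    rw [waveB0InvSqrt, waveB0, Matrix.diagonal_mul_diagonal, Matrix.diagonal_mul_diagonal,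
      ← Matrix.diagonal_one]
    congr 1
    funext i
    fin_cases i
    · simp
    all_goals exact h1
  rw [sysA0InvSqrt, sysA0, ← Matrix.blockDiagonal_mul, ← Matrix.blockDiagonal_mul]
  simp only [hk]
  exact Matrix.blockDiagonal_one

end Coeffs

/-! ### Weak derivatives and curves in `L²_loc` -/

/-- Test functions: smooth with compact support. -/
def IsTest {X F : Type*} [NormedAddCommGroup X] [NormedSpace ℝ X] [NormedAddCommGroup F]
    [NormedSpace ℝ F] (φ : X → F) : Prop :=
  ContDiff ℝ ∞ φ ∧ HasCompactSupport φ

/-- `f ∈ L²_loc(ℝ³)`. -/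
def L2loc {F : Type*} [NormedAddCommGroup F] (f : E3 → F) : Prop :=
  ∀ R : ℝ, MemLp f 2 (volume.restrict (Metric.ball (0 : E3) R))

/-- `f ∈ C(ℝ; L²_loc(ℝ³))`. -/
def ContL2loc {F : Type*} [NormedAddCommGroup F] (f : ℝ → E3 → F) : Prop :=
  (∀ t, L2loc (f t)) ∧
    ∀ R t₀ : ℝ, Tendsto
      (fun t => eLpNorm (fun x => f t x - f t₀ x) 2 (volume.restrict (Metric.ball (0 : E3) R)))
      (𝓝 t₀) (𝓝 0)

/-- `g` is the time derivative of `f`, as curves in `L²_loc(ℝ³)`. -/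
def HasTimeDeriv (f g : ℝ → E3 → E3) : Prop :=
  ∀ R t₀ : ℝ, Tendsto
    (fun h : ℝ => eLpNorm (fun x => h⁻¹ • (f (t₀ + h) x - f t₀ x) - g t₀ x) 2
      (volume.restrict (Metric.ball (0 : E3) R)))
    (𝓝[≠] 0) (𝓝 0)

/-- `G i j` is the weak partial derivative `∂ⱼ wᵢ` of the vector field `w`. -/
def HasWeakGrad (w : E3 → E3) (G : E3 → Fin 3 → Fin 3 → ℝ) : Prop :=
  ∀ i j : Fin 3, ∀ φ : E3 → ℝ, IsTest φ →
    ∫ x, w x i * fderiv ℝ φ x (e j) = -∫ x, G x i j * φ x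

/-- `d` is the weak divergence of the vector field `w`; here `fderiv ℝ φ x (w x) = w · ∇φ`. -/
def HasWeakDiv (w : E3 → E3) (d : E3 → ℝ) : Prop :=
  ∀ φ : E3 → ℝ, IsTest φ → ∫ x, fderiv ℝ φ x (w x) = -∫ x, d x * φ x

/-- For a closed set `K`: the support of `(ws, div wf)` is contained in `K`. The function `ws`
vanishes almost everywhere outside `K`, and the distribution `div wf` vanishes on the open set
`Kᶜ`. -/
def PairSuppIn (ws wf : E3 → E3) (K : Set E3) : Prop :=
  (∀ᵐ x : E3, x ∉ K → ws x = 0) ∧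
    ∀ φ : E3 → ℝ, IsTest φ → tsupport φ ⊆ Kᶜ → ∫ x, fderiv ℝ φ x (wf x) = 0

/-! ### Solutions of the Biot equations -/

/-- Divergence `tr G` of a vector field with gradient `G`. -/
def tr3 (G : Fin 3 → Fin 3 → ℝ) : ℝ := ∑ i, G i i

/-- The stress tensor `τ = (λ div u^s + q div u^f) I₃ + μ (∇u^s + (∇u^s)ᵀ)` at the point `x`,
where `G = ∇u^s(x)` and `d = div u^f(x)`. -/
def stress (C : Coeffs) (x : E3) (G : Fin 3 → Fin 3 → ℝ) (d : ℝ) (i j : Fin 3) : ℝ :=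
  (if i = j then C.lam x * tr3 G + C.q x * d else 0) + C.mu x * (G i j + G j i)

/-- The pore pressure `p = -(q div u^s + r div u^f)`. -/
def pressure (C : Coeffs) (x : E3) (G : Fin 3 → Fin 3 → ℝ) (d : ℝ) : ℝ :=
  -(C.q x * tr3 G + C.r x * d)

/-- The second time derivative of `w` at `(t, x)`. -/
def dtt (w : ℝ → E3 → E3) (t : ℝ) (x : E3) : E3 := iteratedDeriv 2 (fun s => w s x) t

/-- The partial derivative `∂ⱼ wᵢ`. -/
def pd (w : E3 → E3) (x : E3) (i j : Fin 3) : ℝ := fderiv ℝ w x (e j) i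

/-- `u = (us, uf)` is a weak solution with locally finite energy of `M ∂_t² u + P(D) u = 0` in
`ℝ × ℝ³`, with time derivative `(vs, vf)`:
`u ∈ C¹(ℝ; L²_loc)`, `∇us ∈ C(ℝ; L²_loc)`, `div uf ∈ C(ℝ; L²_loc)`, and the two equations
`ρ₁₁ ∂_t² us + ρ₁₂ ∂_t² uf - div τ = 0`, `ρ₁₂ ∂_t² us + ρ₂₂ ∂_t² uf + ∇p = 0`
(where `div τ = Δ_{μ,λ} us + ∇(q div uf)` and `-∇p = ∇(q div us) + ∇(r div uf)`)
hold in the sense of distributions. Every classical solution of class `C²` is one. -/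
structure IsSolution (C : Coeffs) (us uf vs vf : ℝ → E3 → E3) : Prop where
  cont_us : ContL2loc us
  cont_uf : ContL2loc uf
  cont_vs : ContL2loc vs
  cont_vf : ContL2loc vf
  deriv_us : HasTimeDeriv us vs
  deriv_uf : HasTimeDeriv uf vf
  weak : ∃ (G : ℝ → E3 → Fin 3 → Fin 3 → ℝ) (d : ℝ → E3 → ℝ),
    ContL2loc G ∧ ContL2loc d ∧
    (∀ t, HasWeakGrad (us t) (G t)) ∧ (∀ t, HasWeakDiv (uf t) (d t)) ∧
    (∀ w : ℝ → E3 → E3, IsTest (Function.uncurry w) →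
      ∫ t, ∫ x, (inner ℝ (C.rho11 x • us t x + C.rho12 x • uf t x) (dtt w t x) +
        ∑ i, ∑ j, stress C x (G t x) (d t x) i j * pd (w t) x i j) = 0) ∧
    (∀ w : ℝ → E3 → E3, IsTest (Function.uncurry w) →
      ∫ t, ∫ x, (inner ℝ (C.rho12 x • us t x + C.rho22 x • uf t x) (dtt w t x) -
        pressure C x (G t x) (d t x) * tr3 (pd (w t) x)) = 0)

end

end Biot

/-! The proof is a weighted local energy estimate for Biot's system itself. The 40×40 system enters
only through `cmax`, which dominates √a₁ and √μ₁ (`Coeffs.sqrt_waveCoeff_le_cmax`).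

Let M be the mass form and S the elastic form. On the strain of a plane wave with covector ν, S
splits into a part along ν, governed by the matrix A, and a part across ν, governed by μ₁. So S is
at most c²|ν|² times M when a₁, μ₁ ≤ c² (`strainForm_symbol_le`), and the energy flux is at most
c|ν| times the energy density (`abs_strainForm_symbol_le`).

The usual multiplier ∂ₜu is not admissible, because its spatial derivatives need not be square
integrable. Integrating the equation once in time lowers the order by one. Let Y = (∇us, div uf),
let Z be its time integral from 0, and let w be u minus the field (0, uf(0) + t vf(0)). On a ball
B(x₀, b) missing the support of the data, that field is divergence free in the fluid slot, so w has
strain Y, and the integrated equation links w' with Z. The admissible multiplier g·w, with g a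
cutoff, turns it into an energy law for ½∫ g (M(w,w) + S(Z,Z)), which vanishes at time 0
(`integrated_weak`, `energy_balance`).

No moving cone is needed: g is a fixed weight close to exp(-k|x-x₀|), with |∇g| ≤ k g up to an error
that is exponentially smaller. Gronwall's inequality costs exp(kc|t|), and k → ∞ forces w(t) = 0
near x₀ whenever c|t| < b (`exists_weight`, `energy_vanish`). Thus us(t) = 0 and uf(t) = uf(0) + t
vf(0) locally outside the domain of influence, and the divergence of the latter vanishes there
(`local_vanish`, `finite_speed`). -/

set_option maxSynthPendingDepth 3

open MeasureTheory Filter Topology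
open scoped ContDiff Convolution

/-! ### Mollification: weak identities extended from test functions to fields of finite energy. -/

namespace Biot

/-- du Bois-Reymond: a continuous function with vanishing distributional derivative is constant. -/
theorem eq_of_integral_mul_deriv_eq_zero {h : ℝ → ℝ} (hh : Continuous h)
    (H : ∀ θ : ℝ → ℝ, IsTest θ → ∫ s, h s * deriv θ s = 0) (a b : ℝ) : h a = h b := by
  let φ : ℕ → ContDiffBump (0 : ℝ) := fun n =>
    ⟨1 / ((n : ℝ) + 1) / 2, 1 / ((n : ℝ) + 1), by positivity, half_lt_self (by positivity)⟩
  have hφ : Tendsto (fun n => (φ n).rOut) atTop (𝓝 0) := tendsto_one_div_add_atTop_nhds_zero_nat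
  have key : ∀ n, ((φ n).normed volume ⋆[ContinuousLinearMap.lsmul ℝ ℝ, volume] h) a =
      ((φ n).normed volume ⋆[ContinuousLinearMap.lsmul ℝ ℝ, volume] h) b := by
    intro n
    have hd : ∀ x, HasDerivAt
        ((φ n).normed volume ⋆[ContinuousLinearMap.lsmul ℝ ℝ, volume] h) 0 x := by
      intro x
      have h1 := HasCompactSupport.hasDerivAt_convolution_left (ContinuousLinearMap.lsmul ℝ ℝ)
        (φ n).hasCompactSupport_normed ((φ n).contDiff_normed (n := 1) (μ := volume))
        (hh.locallyIntegrable (μ := volume)) x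
      -- The derivative of the mollification at `x` is, up to sign, the pairing of `h` with the
      -- derivative of the reflected bump, which vanishes by hypothesis. So every mollification is
      -- constant.
      suffices h0 : (deriv ((φ n).normed volume)
          ⋆[ContinuousLinearMap.lsmul ℝ ℝ, volume] h) x = 0 by rwa [h0] at h1
      have hθ : IsTest fun y => (φ n).normed volume (x - y) := by
        refine ⟨(φ n).contDiff_normed.comp (contDiff_const.sub contDiff_id), ?_⟩
        exact (φ n).hasCompactSupport_normed.comp_homeomorph (Homeomorph.subLeft x)
      have h2 := H _ hθ
      rw [convolution_eq_swap]
      have h3 : ∀ y, deriv (fun y => (φ n).normed volume (x - y)) y =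
          - deriv ((φ n).normed volume) (x - y) := fun y => deriv_comp_const_sub _ x y
      simp only [h3, mul_neg, integral_neg, neg_eq_zero] at h2
      simp only [ContinuousLinearMap.lsmul_apply, smul_eq_mul]
      refine Eq.trans ?_ h2
      congr 1
      funext y
      ring
    exact is_const_of_deriv_eq_zero (fun x => (hd x).differentiableAt) (fun x => (hd x).deriv) a b
  refine tendsto_nhds_unique
    (ContDiffBump.convolution_tendsto_right_of_continuous (μ := volume) hφ hh a) ?_
  simp only [key]
  exact ContDiffBump.convolution_tendsto_right_of_continuous (μ := volume) hφ hh b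

/-- The correlation of two square integrable functions is continuous. -/
theorem continuous_integral_mul_translate {F f : E3 → ℝ} (hF : MemLp F 2 volume)
    (hf : MemLp f 2 volume) : Continuous fun y => ∫ x, F x * f (x + y) := by
  have hmp : ∀ y : E3, MeasurePreserving (ContinuousMap.addRight y) volume volume :=
    fun y => measurePreserving_add_right volume y
  -- Translation acts continuously on L², and the correlation is an inner product with a translate.
  have hc : Continuous fun y : E3 =>
      Lp.compMeasurePreserving (ContinuousMap.addRight y) (hmp y) (hf.toLp f) := by
    refine Continuous.compMeasurePreservingLp continuous_const ?_ hmp (by simp)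
    refine ContinuousMap.continuous_of_continuous_uncurry _ ?_
    simp only [Function.uncurry_def, ContinuousMap.coe_addRight]
    fun_prop
  have h2 : Continuous fun y : E3 => inner ℝ (hF.toLp F)
      (Lp.compMeasurePreserving (ContinuousMap.addRight y) (hmp y) (hf.toLp f)) :=
    continuous_const.inner hc
  convert h2 using 2 with y
  rw [L2.inner_def]
  refine integral_congr_ae ?_
  filter_upwards [hF.coeFn_toLp, Lp.coeFn_compMeasurePreserving (hf.toLp f) (hmp y),
    (hmp y).quasiMeasurePreserving.ae_eq_comp hf.coeFn_toLp] with x h1 h2 h3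
  rw [h1, h2, h3]
  simp [mul_comm]

/-- Weak convergence of mollifications in `L²`. -/
theorem tendsto_integral_mul_mollify {F f : E3 → ℝ} (hF : MemLp F 2 volume)
    (hf : MemLp f 2 volume) {φ : ℕ → ContDiffBump (0 : E3)}
    (hφ : Tendsto (fun n => (φ n).rOut) atTop (𝓝 0)) :
    Tendsto (fun n => ∫ x, F x *
      ((φ n).normed volume ⋆[ContinuousLinearMap.lsmul ℝ ℝ, volume] f) x)
      atTop (𝓝 (∫ x, F x * f x)) := by
  have hc := (continuous_integral_mul_translate hF hf)
  -- By Fubini, pairing `F` with the mollification of `f` is mollifying the correlation of `F` and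
  -- `f` at the origin. The correlation is continuous, so pointwise convergence there is enough.
  have h1 := ContDiffBump.convolution_tendsto_right_of_continuous (μ := volume) hφ hc 0
  simp only [add_zero] at h1
  convert h1 using 2 with n
  set η := (φ n).normed volume with hη
  have hηc : Continuous η := (φ n).contDiff_normed (n := 0).continuous
  have hηi : Integrable η := hηc.integrable_of_hasCompactSupport (φ n).hasCompactSupport_normed
  have hη0 : ∀ x, 0 ≤ η x := (φ n).nonneg_normed
  simp only [convolution_def, ContinuousLinearMap.lsmul_apply, smul_eq_mul, zero_sub,
    ← sub_eq_add_neg, ← integral_const_mul]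
  rw [integral_integral_swap]
  · congr 1
    funext y
    congr 1
    funext x
    ring
  have hm : AEStronglyMeasurable (fun p : E3 × E3 => η p.2 * f (p.1 - p.2))
      (volume.prod volume) :=
    AEStronglyMeasurable.convolution_integrand (ContinuousLinearMap.lsmul ℝ ℝ)
      hηi.aestronglyMeasurable hf.1
  have i1 : Integrable (fun p : E3 × E3 => F p.1 ^ 2 * η p.2) (volume.prod volume) :=
    (hF.integrable_sq).mul_prod hηi
  have i2 : Integrable (fun p : E3 × E3 => η p.2 * f (p.1 - p.2) ^ 2) (volume.prod volume) :=
    Integrable.convolution_integrand (ContinuousLinearMap.lsmul ℝ ℝ) hηi hf.integrable_sq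
  -- Domination |F f| ≤ F² + f², with the nonnegative weight η carried along.
  refine (i1.add i2).mono' (hF.1.comp_fst.mul hm) (Eventually.of_forall fun p => ?_)
  rcases p with ⟨x, y⟩
  simp only [Function.uncurry_apply_pair, Pi.add_apply, Real.norm_eq_abs]
  have := hη0 y
  rw [show F x * (η y * f (x - y)) = η y * (F x * f (x - y)) by ring, abs_mul,
    abs_of_nonneg this, mul_comm (F x ^ 2), ← mul_add]
  refine mul_le_mul_of_nonneg_left ?_ this
  rw [abs_le]
  constructor <;> nlinarith [sq_nonneg (F x + f (x - y)), sq_nonneg (F x - f (x - y))]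

/-- Reflection and translation of a test function. -/
theorem IsTest.comp_sub_left {η : E3 → ℝ} (hη : IsTest η) (x : E3) :
    IsTest fun y => η (x - y) :=
  ⟨hη.1.comp (contDiff_const.sub contDiff_id),
    hη.2.comp_homeomorph (Homeomorph.subLeft x)⟩

theorem fderiv_comp_sub_left {η : E3 → ℝ} (hη : IsTest η) (x y v : E3) :
    fderiv ℝ (fun y => η (x - y)) y v = - fderiv ℝ η (x - y) v := by
  have h1 : HasFDerivAt η (fderiv ℝ η (x - y)) (x - y) :=
    (hη.1.differentiable (by simp) _).hasFDerivAt
  have h2 := h1.comp y ((hasFDerivAt_id y).const_sub x)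
  have h3 := h2.fderiv
  simp only [Function.comp_def] at h3
  rw [h3]
  simp

/-- The derivative of a mollification, as a pairing with a test function. -/
theorem fderiv_convolution_apply {η f : E3 → ℝ} (hη : IsTest η) (hf : LocallyIntegrable f)
    (x v : E3) :
    fderiv ℝ (η ⋆[ContinuousLinearMap.lsmul ℝ ℝ, volume] f) x v =
      -∫ y, f y * fderiv ℝ (fun y => η (x - y)) y v := by
  have h1 := HasCompactSupport.hasFDerivAt_convolution_left (ContinuousLinearMap.lsmul ℝ ℝ)
    hη.2 (hη.1.of_le (by simp)) hf x
  have hex : ConvolutionExistsAt (fderiv ℝ η) f x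
      ((ContinuousLinearMap.lsmul ℝ ℝ).precompL E3) volume :=
    HasCompactSupport.convolutionExists_left _ (hη.2.fderiv ℝ)
      (hη.1.continuous_fderiv (by simp)) hf x
  rw [h1.fderiv, convolution_eq_swap, ContinuousLinearMap.integral_apply, ← integral_neg]
  · congr 1
    funext y
    rw [fderiv_comp_sub_left hη]
    simp [ContinuousLinearMap.precompL_apply, mul_comm]
  · exact hex.integrable_swap

theorem convolution_apply_eq {η f : E3 → ℝ} (x : E3) :
    (η ⋆[ContinuousLinearMap.lsmul ℝ ℝ, volume] f) x = ∫ y, f y * η (x - y) := by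
  rw [convolution_eq_swap]
  simp [mul_comm]

/-- Mollifications of a compactly supported function are test functions. -/
theorem isTest_mollify {f : E3 → ℝ} (hf : LocallyIntegrable f) {K : Set E3} (hK : IsCompact K)
    (hfK : ∀ x ∉ K, f x = 0) (φ : ContDiffBump (0 : E3)) :
    IsTest (φ.normed volume ⋆[ContinuousLinearMap.lsmul ℝ ℝ, volume] f) :=
  ⟨φ.hasCompactSupport_normed.contDiff_convolution_left _ φ.contDiff_normed hf,
    (φ.hasCompactSupport_normed).convolution _ (HasCompactSupport.intro hK hfK)⟩

/-- Supports add under convolution, so the mollification lives in the thickening of `K` by the bump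
radius, and a compact set has a thickening inside `U`. -/
theorem eventually_tsupport_mollify_subset {f : E3 → ℝ} {K U : Set E3}
    (hK : IsCompact K) (hU : IsOpen U) (hKU : K ⊆ U) (hfK : ∀ x ∉ K, f x = 0)
    {φ : ℕ → ContDiffBump (0 : E3)} (hφ : Tendsto (fun n => (φ n).rOut) atTop (𝓝 0)) :
    ∀ᶠ n in atTop, tsupport
      ((φ n).normed volume ⋆[ContinuousLinearMap.lsmul ℝ ℝ, volume] f) ⊆ U := by
  obtain ⟨δ, hδ, hδU⟩ := hK.exists_cthickening_subset_open hU hKU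
  filter_upwards [hφ.eventually (gt_mem_nhds hδ)] with n hn
  refine subset_trans (closure_minimal ?_ Metric.isClosed_cthickening) hδU
  refine (support_convolution_subset (ContinuousLinearMap.lsmul ℝ ℝ)).trans ?_
  rw [(φ n).support_normed_eq]
  rintro _ ⟨y, hy, z, hz, rfl⟩
  have hzK : z ∈ K := by
    by_contra h
    exact hz (hfK z h)
  refine Metric.mem_cthickening_of_dist_le _ z _ _ hzK ?_
  rw [mem_ball_zero_iff] at hy
  simpa using (hy.trans hn).le

/-- A sequence of bump functions shrinking to the origin. -/
theorem exists_bump_seq :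
    ∃ φ : ℕ → ContDiffBump (0 : E3), Tendsto (fun n => (φ n).rOut) atTop (𝓝 0) :=
  ⟨fun n => ⟨1 / ((n : ℝ) + 1) / 2, 1 / ((n : ℝ) + 1), by positivity,
    half_lt_self (by positivity)⟩, tendsto_one_div_add_atTop_nhds_zero_nat⟩

theorem isTest_normed (φ : ContDiffBump (0 : E3)) : IsTest (φ.normed volume) :=
  ⟨φ.contDiff_normed, φ.hasCompactSupport_normed⟩

/-- A first order identity for test functions extends to square integrable functions with a square
integrable weak gradient and compact support. -/
theorem integral_add_eq_zero_of_weakGrad {U K : Set E3} (hU : IsOpen U) (hK : IsCompact K)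
    (hKU : K ⊆ U) {A : E3 → ℝ} {T : Fin 3 → E3 → ℝ} (hA : MemLp A 2 volume)
    (hT : ∀ j, MemLp (T j) 2 volume)
    (H : ∀ ϕ : E3 → ℝ, IsTest ϕ → tsupport ϕ ⊆ U →
      (∫ x, A x * ϕ x) + ∑ j, ∫ x, T j x * fderiv ℝ ϕ x (e j) = 0)
    {f : E3 → ℝ} {D : Fin 3 → E3 → ℝ} (hf : MemLp f 2 volume) (hD : ∀ j, MemLp (D j) 2 volume)
    (hfK : ∀ x ∉ K, f x = 0)
    (hfD : ∀ j, ∀ θ : E3 → ℝ, IsTest θ → ∫ x, f x * fderiv ℝ θ x (e j) = -∫ x, D j x * θ x) :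
    (∫ x, A x * f x) + ∑ j, ∫ x, T j x * D j x = 0 := by
  obtain ⟨φ, hφ⟩ := exists_bump_seq
  have hfl : LocallyIntegrable f := hf.locallyIntegrable (by norm_num)
  -- Mollifications of `f` are admissible test functions whose gradients are mollifications of `D`.
  -- Weak convergence suffices, since each term is linear in them.
  have lim := (tendsto_integral_mul_mollify hA hf hφ).add
    (tendsto_finsetSum Finset.univ fun j _ => tendsto_integral_mul_mollify (hT j) (hD j) hφ)
  refine tendsto_nhds_unique (lim.congr' ?_) (tendsto_const_nhds (x := (0 : ℝ)))
  filter_upwards [eventually_tsupport_mollify_subset hK hU hKU hfK hφ] with n hn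
  rw [← H _ (isTest_mollify hfl hK hfK (φ n)) hn]
  congr 1
  refine Finset.sum_congr rfl fun j _ => ?_
  congr 1
  funext x
  rw [fderiv_convolution_apply (isTest_normed _) hfl,
    hfD j _ ((isTest_normed (φ n)).comp_sub_left x), neg_neg, convolution_apply_eq]

/-- The analogue of `integral_add_eq_zero_of_weakGrad` for vector fields with a square integrable
weak divergence. -/
theorem integral_add_eq_zero_of_weakDiv {U K : Set E3} (hU : IsOpen U) (hK : IsCompact K)
    (hKU : K ⊆ U) {A : Fin 3 → E3 → ℝ} {T : E3 → ℝ} (hA : ∀ i, MemLp (A i) 2 volume)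
    (hT : MemLp T 2 volume)
    (H : ∀ i, ∀ ϕ : E3 → ℝ, IsTest ϕ → tsupport ϕ ⊆ U →
      (∫ x, A i x * ϕ x) + ∫ x, T x * fderiv ℝ ϕ x (e i) = 0)
    {f : Fin 3 → E3 → ℝ} {d : E3 → ℝ} (hf : ∀ i, MemLp (f i) 2 volume) (hd : MemLp d 2 volume)
    (hfK : ∀ i, ∀ x ∉ K, f i x = 0)
    (hfd : ∀ θ : E3 → ℝ, IsTest θ →
      ∑ i, ∫ x, f i x * fderiv ℝ θ x (e i) = -∫ x, d x * θ x) :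
    (∑ i, ∫ x, A i x * f i x) + ∫ x, T x * d x = 0 := by
  obtain ⟨φ, hφ⟩ := exists_bump_seq
  have hfl : ∀ i, LocallyIntegrable (f i) := fun i => (hf i).locallyIntegrable (by norm_num)
  have lim := (tendsto_finsetSum Finset.univ fun i _ =>
    tendsto_integral_mul_mollify (hA i) (hf i) hφ).add (tendsto_integral_mul_mollify hT hd hφ)
  refine tendsto_nhds_unique (lim.congr' ?_) (tendsto_const_nhds (x := (0 : ℝ)))
  filter_upwards [eventually_all.2 fun i =>
    eventually_tsupport_mollify_subset hK hU hKU (hfK i) hφ] with n hn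
  have ht := fun i => isTest_mollify (hfl i) hK (hfK i) (φ n)
  have h0 := Finset.sum_eq_zero fun i (_ : i ∈ Finset.univ) => H i _ (ht i) (hn i)
  rw [← h0, Finset.sum_add_distrib]
  congr 1
  -- The single partial derivatives have no limit in L². Only their sum does, being the
  -- mollification of `d`, so the three terms must be recombined first.
  rw [← integral_finsetSum]
  · congr 1
    funext x
    rw [← Finset.mul_sum]
    congr 1
    simp only [fderiv_convolution_apply (isTest_normed _) (hfl _)]
    rw [Finset.sum_neg_distrib, hfd _ ((isTest_normed (φ n)).comp_sub_left x), neg_neg,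
      convolution_apply_eq]
  · intro i _
    refine hT.integrable_mul (q := 2) ?_
    refine Continuous.memLp_of_hasCompactSupport ?_ ?_
    · exact ((ht i).1.continuous_fderiv (by simp)).clm_apply continuous_const
    · exact (ht i).2.fderiv_apply ℝ (e i)

end Biot

/-! ### Characteristic speeds: the principal symbol against the mass matrix. -/

namespace Biot

/-- The larger of the propagation speeds is at least the speed of every scalar wave equation. -/
theorem Coeffs.sqrt_waveCoeff_le_cmax (C : Coeffs) (hC : C.Admissible) (x : E3) (k : Fin 8) :
    ((√(C.waveCoeff x k) : ℝ) : EReal) ≤ C.cmax := by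
  -- One direction suffices, because every block is isotropic.
  have h1 : C.Lambda (e 0) ≤ C.cmax :=
    le_iSup₂ (f := fun ξ (_ : ξ ∈ Metric.sphere (0 : E3) 1) => C.Lambda ξ) (e 0) (by simp [e])
  refine le_trans (le_sInf ?_) h1
  rintro _ ⟨l, hl, rfl⟩
  rw [EReal.coe_le_coe_iff]
  have h2 := hl x
  have hsum : ∑ j : Fin 3, (e 0) j • C.sysA j x = C.sysA 0 x := by
    simp [e]
  rw [hsum, Coeffs.sysA, Coeffs.sysA0InvSqrt, ← Matrix.blockDiagonal_mul,
    ← Matrix.blockDiagonal_mul] at h2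
  -- In block `k`, the unknowns ∂ₜv and ∂₁v are coupled by the entry -√a. The vector (1, -1) turns
  -- this into 2l - 2√a ≥ 0.
  have h3 := h2.submatrix (fun i : Fin 2 => ((![0, 1] i : Fin 5), k))
  have h4 := h3.dotProduct_mulVec_nonneg ![1, -1]
  have hp := hC.waveCoeff_pos x k
  have hs : C.waveCoeff x k * (√(C.waveCoeff x k))⁻¹ = √(C.waveCoeff x k) := by
    have := (Real.sqrt_pos.2 hp).ne'
    field_simp
    exact (Real.sq_sqrt hp.le).symm
  have hs' : (√(C.waveCoeff x k))⁻¹ * C.waveCoeff x k = √(C.waveCoeff x k) := by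
    rw [mul_comm, hs]
  simp [Matrix.mulVec, dotProduct, Fin.sum_univ_two, Matrix.blockDiagonal_apply, waveB0InvSqrt,
    waveB, Matrix.diagonal_mul, Matrix.mul_diagonal, Matrix.one_apply, hs, hs'] at h4
  linarith

/-- If a symmetric `2 × 2` form has nonnegative determinant and nonnegative mixed determinant with a
positive definite one, its first entry is nonnegative. -/
theorem entry_nonneg_of_mixed_det {m₁ m₂ m₃ p₁ p₂ p₃ : ℝ} (hm₁ : 0 < m₁) (hm₃ : 0 < m₃)
    (hm : 0 < m₁ * m₃ - m₂ ^ 2) (hdet : 0 ≤ p₁ * p₃ - p₂ ^ 2)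
    (hmix : 0 ≤ p₁ * m₃ - 2 * p₂ * m₂ + p₃ * m₁) : 0 ≤ p₁ := by
  -- If p₁ < 0, the determinant condition forces p₃ ≤ 0. The mixed condition then bounds (p₁m₃ +
  -- p₃m₁)² by 4p₂²m₂², hence by 4p₁p₃m₂², while it is at least 4p₁p₃m₁m₃. So p₁p₃ = 0, whence p₃ =
  -- p₂ = 0, and the mixed condition fails.
  by_contra! h
  have h3 : p₃ ≤ 0 := by
    by_contra! h3
    nlinarith [mul_neg_of_neg_of_pos h h3, sq_nonneg p₂]
  have hs : 0 ≤ -(p₁ * m₃ + p₃ * m₁) := by nlinarith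
  have h4 : (p₁ * m₃ + p₃ * m₁) ^ 2 ≤ (2 * p₂ * m₂) ^ 2 := by
    have : -(p₁ * m₃ + p₃ * m₁) ≤ -(2 * p₂ * m₂) := by linarith
    nlinarith
  have h5 : p₂ ^ 2 * m₂ ^ 2 ≤ p₁ * p₃ * m₂ ^ 2 :=
    mul_le_mul_of_nonneg_right (by linarith) (sq_nonneg _)
  have h6 : 0 ≤ p₁ * p₃ * (m₁ * m₃ - m₂ ^ 2) := mul_nonneg (by nlinarith) hm.le
  have h7 : p₁ * p₃ * (m₁ * m₃ - m₂ ^ 2) = 0 := by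
    nlinarith [sq_nonneg (p₁ * m₃ - p₃ * m₁)]
  have h8 : p₃ = 0 := by
    rcases mul_eq_zero.1 h7 with h | h
    · rcases mul_eq_zero.1 h with h | h
      · linarith
      · exact h
    · linarith
  have h9 : p₂ = 0 := by
    have : p₂ ^ 2 ≤ 0 := by rw [h8] at hdet; linarith
    exact pow_eq_zero_iff (two_ne_zero) |>.1 (le_antisymm this (sq_nonneg _))
  rw [h8, h9] at hmix
  nlinarith

theorem Coeffs.Admissible.pos {C : Coeffs} (hC : C.Admissible) (x : E3) : 0 < C.rho11 x ∧ 0 < C.rho22 x ∧ 0 < C.mu x ∧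
    0 < C.lam x ∧ 0 < C.r x := by
  obtain ⟨c, hc, h11, h12, h22, hmu, hlam, hq, hr⟩ := hC.nice
  exact ⟨hc.trans_le (h11.lower x), hc.trans_le (h22.lower x), hc.trans_le (hmu.lower x),
    hc.trans_le (hlam.lower x), hc.trans_le (hr.lower x)⟩

/-- The longitudinal part of the principal symbol is bounded by the mass form. -/
theorem longitudinal_le {C : Coeffs} (hC : C.Admissible) {x : E3} {s : ℝ} (hs : C.a1 x ≤ s) (α β : ℝ) :
    (2 * C.mu x + C.lam x) * α ^ 2 + 2 * C.q x * α * β + C.r x * β ^ 2 ≤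
      s * (C.rho11 x * α ^ 2 + 2 * C.rho12 x * α * β + C.rho22 x * β ^ 2) := by
  obtain ⟨h11, h22, hmu, hlam, hr⟩ := hC.pos x
  have hρ := hC.mass_pos x
  have hρ' : C.rho x = C.rho11 x * C.rho22 x - C.rho12 x ^ 2 := rfl
  have hD := hC.disc_nonneg x
  have hsq := Real.sq_sqrt hD
  have hsn := Real.sqrt_nonneg ((C.matA x).trace ^ 2 - 4 * (C.matA x).det)
  have ha1 : C.a1 x = ((C.matA x).trace + √((C.matA x).trace ^ 2 - 4 * (C.matA x).det)) / 2 := rfl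
  have htr : C.rho x * (C.matA x).trace = C.rho22 x * (2 * C.mu x + C.lam x) -
      2 * (C.rho12 x * C.q x) + C.rho11 x * C.r x := by
    have hne : C.rho x ≠ 0 := by rw [hρ']; exact hρ.ne'
    simp only [Coeffs.matA, Matrix.trace_fin_two, Matrix.smul_apply, smul_eq_mul,
      Matrix.mul_apply, Fin.sum_univ_two, Matrix.of_apply, Matrix.cons_val',
      Matrix.cons_val_zero, Matrix.cons_val_one, Matrix.cons_val_fin_one]
    field_simp
    ring
  have hdet : C.rho x * (C.matA x).det =
      (2 * C.mu x + C.lam x) * C.r x - C.q x ^ 2 := by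
    have hne : C.rho x ≠ 0 := by rw [hρ']; exact hρ.ne'
    simp only [Coeffs.matA, Matrix.det_smul, Matrix.det_mul, Matrix.det_fin_two_of,
      Fintype.card_fin]
    field_simp
    rw [hρ']
    ring
  generalize √((C.matA x).trace ^ 2 - 4 * (C.matA x).det) = D at *
  generalize (C.matA x).trace = T at *
  generalize (C.matA x).det = Δ at *
  rw [ha1] at hs
  -- `s` is not below the larger root of the characteristic polynomial of A. With M the mass matrix
  -- and K the longitudinal moduli, ρ times this polynomial is det(sM - K), and ρ times its
  -- derivative is the mixed determinant of sM - K and M. Both being nonnegative makes sM - K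
  -- positive semidefinite.
  have hp : 0 ≤ s ^ 2 - T * s + Δ := by nlinarith
  have hT : 0 ≤ 2 * s - T := by linarith
  have e1 : 0 ≤ (s * C.rho11 x - (2 * C.mu x + C.lam x)) * (s * C.rho22 x - C.r x) -
      (s * C.rho12 x - C.q x) ^ 2 := by
    have := mul_nonneg hρ.le hp
    rw [← hρ'] at this
    have e : (s * C.rho11 x - (2 * C.mu x + C.lam x)) * (s * C.rho22 x - C.r x) -
      (s * C.rho12 x - C.q x) ^ 2 = C.rho x * (s ^ 2 - T * s + Δ) := by
      have : C.rho x * (s ^ 2 - T * s + Δ) =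
        C.rho x * s ^ 2 - (C.rho x * T) * s + C.rho x * Δ := by ring
      rw [this, htr, hdet, hρ']
      ring
    rw [e]
    exact this
  have e2 : 0 ≤ (s * C.rho11 x - (2 * C.mu x + C.lam x)) * C.rho22 x -
      2 * (s * C.rho12 x - C.q x) * C.rho12 x + (s * C.rho22 x - C.r x) * C.rho11 x := by
    have := mul_nonneg hρ.le hT
    rw [← hρ'] at this
    have e : C.rho x * (2 * s - T) = 2 * s * C.rho x - C.rho x * T := by ring
    rw [e, htr, hρ'] at this
    linarith
  have p1 := entry_nonneg_of_mixed_det h11 h22 hρ e1 e2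
  have p3 := entry_nonneg_of_mixed_det (p₁ := s * C.rho22 x - C.r x)
    (p₂ := s * C.rho12 x - C.q x) (p₃ := s * C.rho11 x - (2 * C.mu x + C.lam x)) (m₂ := C.rho12 x)
    h22 h11 (by linarith) (by linarith) (by linarith)
  generalize hP1 : s * C.rho11 x - (2 * C.mu x + C.lam x) = P1 at *
  generalize hP2 : s * C.rho12 x - C.q x = P2 at *
  generalize hP3 : s * C.rho22 x - C.r x = P3 at *
  have hq : 0 ≤ P1 * α ^ 2 + 2 * P2 * α * β + P3 * β ^ 2 := by
    rcases p1.eq_or_lt with h | h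
    · have : P2 = 0 := by
        have : P2 ^ 2 ≤ 0 := by rw [← h] at e1; linarith
        exact pow_eq_zero_iff two_ne_zero |>.1 (le_antisymm this (sq_nonneg _))
      rw [← h, this]
      have := mul_nonneg p3 (sq_nonneg β)
      linarith
    · have h1 : 0 ≤ P1 * (P1 * α ^ 2 + 2 * P2 * α * β + P3 * β ^ 2) := by
        have : P1 * (P1 * α ^ 2 + 2 * P2 * α * β + P3 * β ^ 2) =
          (P1 * α + P2 * β) ^ 2 + (P1 * P3 - P2 ^ 2) * β ^ 2 := by ring
        rw [this]
        have := mul_nonneg e1 (sq_nonneg β)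
        positivity
      exact nonneg_of_mul_nonneg_right h1 h
  rw [← hP1, ← hP2, ← hP3] at hq
  linarith

/-- The transversal part of the principal symbol is bounded by the mass form. -/
theorem transversal_le {C : Coeffs} (hC : C.Admissible) {x : E3} {s : ℝ} (hs : C.mu1 x ≤ s) (p q : ℝ) :
    C.mu x * p ^ 2 ≤ s * (C.rho11 x * p ^ 2 + 2 * C.rho12 x * p * q + C.rho22 x * q ^ 2) := by
  obtain ⟨h11, h22, hmu, hlam, hr⟩ := hC.pos x
  have hρ := hC.mass_pos x
  have hρ' : C.rho x = C.rho11 x * C.rho22 x - C.rho12 x ^ 2 := rfl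
  rw [← hρ'] at hρ
  have h1 : C.rho22 x * C.mu x ≤ s * C.rho x := by
    have : C.mu1 x = (C.rho22 x * C.mu x) / C.rho x := by
      simp only [Coeffs.mu1]; field_simp
    rw [this, div_le_iff₀ hρ] at hs
    exact hs
  have h2 : C.rho22 x * (C.mu x * p ^ 2) ≤ C.rho22 x *
      (s * (C.rho11 x * p ^ 2 + 2 * C.rho12 x * p * q + C.rho22 x * q ^ 2)) := by
    have hs0 : 0 ≤ s := by
      have := mul_pos h22 hmu
      by_contra! h
      nlinarith
    -- Completing the square in the fluid amplitude: its best choice leaves the effective density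
    -- ρ/ρ₂₂, whence the speed μ₁.
    have e : C.rho22 x *
      (s * (C.rho11 x * p ^ 2 + 2 * C.rho12 x * p * q + C.rho22 x * q ^ 2)) =
      s * C.rho x * p ^ 2 + s * (C.rho12 x * p + C.rho22 x * q) ^ 2 := by rw [hρ']; ring
    rw [e]
    have := mul_le_mul_of_nonneg_right h1 (sq_nonneg p)
    have := mul_nonneg hs0 (sq_nonneg (C.rho12 x * p + C.rho22 x * q))
    linarith
  exact le_of_mul_le_mul_left h2 h22

/-! ### The kinetic and elastic energy densities as symmetric bilinear forms. -/

noncomputable section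

/-- Pairs of vectors: displacements and velocities of the solid and the fluid. -/
abbrev VecPair := E3 × E3

/-- Pairs of a displacement gradient and a divergence. -/
abbrev Strain := (Fin 3 → Fin 3 → ℝ) × ℝ

/-- The bilinear form `((a, b), (a', b')) ↦ ⟪a, a'⟫`. -/
def massForm11 : VecPair →L[ℝ] VecPair →L[ℝ] ℝ :=
  (LinearMap.mk₂ ℝ (fun v w : VecPair => inner ℝ v.1 w.1) (by simp [inner_add_left])
    (by simp [real_inner_smul_left]) (by simp [inner_add_right])
    (by simp [real_inner_smul_right])).toContinuousBilinearMap

/-- The bilinear form `((a, b), (a', b')) ↦ ⟪a, b'⟫ + ⟪b, a'⟫`. -/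
def massForm12 : VecPair →L[ℝ] VecPair →L[ℝ] ℝ :=
  (LinearMap.mk₂ ℝ (fun v w : VecPair => inner ℝ v.1 w.2 + inner ℝ v.2 w.1)
    (fun a b c => by simp [inner_add_left]; ring)
    (fun a b c => by simp [real_inner_smul_left]; ring)
    (fun a b c => by simp [inner_add_right]; ring)
    (fun a b c => by simp [real_inner_smul_right]; ring)).toContinuousBilinearMap

/-- The bilinear form `((a, b), (a', b')) ↦ ⟪b, b'⟫`. -/
def massForm22 : VecPair →L[ℝ] VecPair →L[ℝ] ℝ :=
  (LinearMap.mk₂ ℝ (fun v w : VecPair => inner ℝ v.2 w.2) (by simp [inner_add_left])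
    (by simp [real_inner_smul_left]) (by simp [inner_add_right])
    (by simp [real_inner_smul_right])).toContinuousBilinearMap

/-- The kinetic energy density as a bilinear form. -/
def massForm (C : Coeffs) (x : E3) : VecPair →L[ℝ] VecPair →L[ℝ] ℝ :=
  C.rho11 x • massForm11 + C.rho12 x • massForm12 + C.rho22 x • massForm22

theorem massForm_apply (C : Coeffs) (x : E3) (v w : VecPair) :
    massForm C x v w = C.rho11 x * inner ℝ v.1 w.1 +
      C.rho12 x * (inner ℝ v.1 w.2 + inner ℝ v.2 w.1) + C.rho22 x * inner ℝ v.2 w.2 := rfl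

theorem tr3_add (G H : Fin 3 → Fin 3 → ℝ) : tr3 (G + H) = tr3 G + tr3 H := by
  simp [tr3, Finset.sum_add_distrib]

theorem tr3_smul (c : ℝ) (G : Fin 3 → Fin 3 → ℝ) : tr3 (c • G) = c * tr3 G := by
  simp [tr3, Finset.mul_sum]

/-- The bilinear form `((G, d), (H, d')) ↦ tr G tr H`. -/
def strainFormLam : Strain →L[ℝ] Strain →L[ℝ] ℝ :=
  (LinearMap.mk₂ ℝ (fun v w : Strain => tr3 v.1 * tr3 w.1)
    (fun a b c => by simp only [Prod.fst_add, tr3_add]; ring)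
    (fun a b c => by simp only [Prod.smul_fst, tr3_smul, smul_eq_mul]; ring)
    (fun a b c => by simp only [Prod.fst_add, tr3_add]; ring)
    (fun a b c => by simp only [Prod.smul_fst, tr3_smul, smul_eq_mul]; ring)
    ).toContinuousBilinearMap

/-- The bilinear form `((G, d), (H, d')) ↦ d tr H + d' tr G`. -/
def strainFormQ : Strain →L[ℝ] Strain →L[ℝ] ℝ :=
  (LinearMap.mk₂ ℝ (fun v w : Strain => v.2 * tr3 w.1 + tr3 v.1 * w.2)
    (fun a b c => by simp only [Prod.fst_add, Prod.snd_add, tr3_add]; ring)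
    (fun a b c => by simp only [Prod.smul_fst, Prod.smul_snd, tr3_smul, smul_eq_mul]; ring)
    (fun a b c => by simp only [Prod.fst_add, Prod.snd_add, tr3_add]; ring)
    (fun a b c => by simp only [Prod.smul_fst, Prod.smul_snd, tr3_smul, smul_eq_mul]; ring)
    ).toContinuousBilinearMap

/-- The bilinear form `((G, d), (H, d')) ↦ d d'`. -/
def strainFormR : Strain →L[ℝ] Strain →L[ℝ] ℝ :=
  (LinearMap.mk₂ ℝ (fun v w : Strain => v.2 * w.2)
    (fun a b c => by simp only [Prod.snd_add]; ring)
    (fun a b c => by simp only [Prod.smul_snd, smul_eq_mul]; ring)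
    (fun a b c => by simp only [Prod.snd_add]; ring)
    (fun a b c => by simp only [Prod.smul_snd, smul_eq_mul]; ring)
    ).toContinuousBilinearMap

/-- The bilinear form `((G, d), (H, d')) ↦ (G + Gᵀ) : H`. -/
def strainFormMu : Strain →L[ℝ] Strain →L[ℝ] ℝ :=
  (LinearMap.mk₂ ℝ (fun v w : Strain => ∑ i, ∑ j, (v.1 i j + v.1 j i) * w.1 i j)
    (fun a b c => by simp [Fin.sum_univ_three]; ring)
    (fun a b c => by simp [Fin.sum_univ_three]; ring)
    (fun a b c => by simp [Fin.sum_univ_three]; ring)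
    (fun a b c => by simp [Fin.sum_univ_three]; ring)
    ).toContinuousBilinearMap

/-- The elastic energy density as a bilinear form. -/
def strainForm (C : Coeffs) (x : E3) : Strain →L[ℝ] Strain →L[ℝ] ℝ :=
  C.lam x • strainFormLam + C.q x • strainFormQ + C.r x • strainFormR + C.mu x • strainFormMu

theorem strainForm_apply (C : Coeffs) (x : E3) (v w : Strain) :
    strainForm C x v w = C.lam x * (tr3 v.1 * tr3 w.1) +
      C.q x * (v.2 * tr3 w.1 + tr3 v.1 * w.2) + C.r x * (v.2 * w.2) +
      C.mu x * ∑ i, ∑ j, (v.1 i j + v.1 j i) * w.1 i j := rfl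

theorem massForm_symm (C : Coeffs) (x : E3) (v w : VecPair) :
    massForm C x v w = massForm C x w v := by
  rw [massForm_apply, massForm_apply, real_inner_comm w.1 v.1, real_inner_comm w.2 v.1,
    real_inner_comm w.1 v.2, real_inner_comm w.2 v.2]
  ring

theorem strainForm_symm (C : Coeffs) (x : E3) (v w : Strain) :
    strainForm C x v w = strainForm C x w v := by
  rw [strainForm_apply, strainForm_apply]
  simp only [Fin.sum_univ_three]
  ring

/-- The spatial terms of the two weak equations are values of one symmetric form, on test strains
with only a solid part here and only a fluid part in `neg_pressure_mul`. This symmetry makes the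
elastic energy quadratic. -/
theorem sum_stress_mul (C : Coeffs) (x : E3) (G H : Fin 3 → Fin 3 → ℝ) (d : ℝ) :
    ∑ i, ∑ j, stress C x G d i j * H i j = strainForm C x (G, d) (H, 0) := by
  rw [strainForm_apply]
  simp [stress, Fin.sum_univ_three, tr3]
  ring

theorem neg_pressure_mul (C : Coeffs) (x : E3) (G : Fin 3 → Fin 3 → ℝ) (d d' : ℝ) :
    -(pressure C x G d * d') = strainForm C x (G, d) (0, d') := by
  rw [strainForm_apply]
  simp [pressure, tr3]
  ring

/-- The symmetric gradient and divergence of a plane wave with amplitudes `w` and covector `ν`. -/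
def symbolStrain (ν : E3) (w : VecPair) : Strain :=
  (fun i j => w.1 i * ν j, ∑ i, w.2 i * ν i)

/-- Completing the square in the solid component; the remainder carries the determinant, so both
positivity and definiteness can be read off. -/
theorem rho11_mul_massForm (C : Coeffs) (x : E3) (v : VecPair) :
    C.rho11 x * massForm C x v v = ‖C.rho11 x • v.1 + C.rho12 x • v.2‖ ^ 2 +
      (C.rho11 x * C.rho22 x - C.rho12 x ^ 2) * ‖v.2‖ ^ 2 := by
  rw [massForm_apply]
  simp only [EuclideanSpace.real_norm_sq_eq, PiLp.inner_apply, RCLike.inner_apply, conj_trivial,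
    Fin.sum_univ_three, PiLp.add_apply, PiLp.smul_apply, smul_eq_mul]
  ring

theorem massForm_nonneg {C : Coeffs} (hC : C.Admissible) (x : E3) (v : VecPair) :
    0 ≤ massForm C x v v := by
  refine nonneg_of_mul_nonneg_right ?_ (hC.pos x).1
  rw [rho11_mul_massForm]
  have := (hC.mass_pos x).le
  positivity

theorem eq_zero_of_massForm_eq_zero {C : Coeffs} (hC : C.Admissible) (x : E3) (v : VecPair)
    (h : massForm C x v v = 0) : v = 0 := by
  have h1 := rho11_mul_massForm C x v
  rw [h, mul_zero] at h1
  have h2 : 0 ≤ (C.rho11 x * C.rho22 x - C.rho12 x ^ 2) * ‖v.2‖ ^ 2 :=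
    mul_nonneg (hC.mass_pos x).le (sq_nonneg _)
  have h3 := sq_nonneg ‖C.rho11 x • v.1 + C.rho12 x • v.2‖
  have h4 : v.2 = 0 := by
    have : (C.rho11 x * C.rho22 x - C.rho12 x ^ 2) * ‖v.2‖ ^ 2 = 0 := by linarith
    simpa [(hC.mass_pos x).ne'] using this
  have h5 : v.1 = 0 := by
    have : ‖C.rho11 x • v.1 + C.rho12 x • v.2‖ ^ 2 = 0 := by linarith
    simpa [h4, (hC.pos x).1.ne'] using this
  exact Prod.ext h5 h4

/-- The volumetric part is nonnegative by λr > q², and the shear part is a multiple of the squared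
norm of the symmetrised gradient. -/
theorem strainForm_nonneg {C : Coeffs} (hC : C.Admissible) (x : E3) (v : Strain) :
    0 ≤ strainForm C x v v := by
  obtain ⟨h11, h22, hmu, hlam, hr⟩ := hC.pos x
  have hm := hC.moduli_pos x
  have h1 : 0 ≤ C.lam x * (tr3 v.1 * tr3 v.1) + C.q x * (v.2 * tr3 v.1 + tr3 v.1 * v.2) +
      C.r x * (v.2 * v.2) := by
    refine nonneg_of_mul_nonneg_right ?_ hlam
    have := mul_nonneg hm.le (sq_nonneg v.2)
    nlinarith [sq_nonneg (C.lam x * tr3 v.1 + C.q x * v.2)]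
  have h2 : ∑ i, ∑ j, (v.1 i j + v.1 j i) * v.1 i j =
      (1 / 2) * ∑ i, ∑ j, (v.1 i j + v.1 j i) ^ 2 := by
    simp only [Fin.sum_univ_three]
    ring
  rw [strainForm_apply, h2]
  positivity

/-- The principal symbol is bounded by the mass form. -/
theorem strainForm_symbol_le {C : Coeffs} (hC : C.Admissible) {x : E3} {c : ℝ}
    (h1 : C.a1 x ≤ c ^ 2) (h2 : C.mu1 x ≤ c ^ 2) (ν : E3) (w : VecPair) :
    strainForm C x (symbolStrain ν w) (symbolStrain ν w) ≤
      c ^ 2 * ‖ν‖ ^ 2 * massForm C x w w := by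
  -- Lagrange's identity |a|²|ν|² = (a·ν)² + |a×ν|² splits both forms into the component along ν and
  -- three cross-product components. The along-ν part of the shear term turns λ into 2μ + λ.
  have l := longitudinal_le hC h1 (∑ i, w.1 i * ν i) (∑ i, w.2 i * ν i)
  have t := fun p q => transversal_le hC h2 p q
  have t1 := t (w.1 1 * ν 0 - w.1 0 * ν 1) (w.2 1 * ν 0 - w.2 0 * ν 1)
  have t2 := t (w.1 2 * ν 0 - w.1 0 * ν 2) (w.2 2 * ν 0 - w.2 0 * ν 2)
  have t3 := t (w.1 2 * ν 1 - w.1 1 * ν 2) (w.2 2 * ν 1 - w.2 1 * ν 2)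
  rw [strainForm_apply, massForm_apply]
  simp only [symbolStrain, tr3, Fin.sum_univ_three, EuclideanSpace.real_norm_sq_eq, PiLp.inner_apply,
    RCLike.inner_apply, conj_trivial] at *
  linarith

/-- Cauchy–Schwarz and the arithmetic-geometric mean inequality for the semidefinite elastic form,
read off from its values at κZ ± σ, with σ the plane-wave strain and κ = c‖ν‖. This is where `c`
becomes the propagation speed. -/
theorem abs_strainForm_symbol_le {C : Coeffs} (hC : C.Admissible) {x : E3} {c : ℝ} (hc : 0 < c)
    (h1 : C.a1 x ≤ c ^ 2) (h2 : C.mu1 x ≤ c ^ 2) (ν : E3) (w : VecPair) (Z : Strain) :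
    |strainForm C x Z (symbolStrain ν w)| ≤
      c * ‖ν‖ * ((massForm C x w w + strainForm C x Z Z) / 2) := by
  rcases eq_or_ne ν 0 with rfl | hν
  · have : symbolStrain 0 w = 0 := by
      ext <;> simp [symbolStrain]
    simp [this]
  set κ := c * ‖ν‖ with hκ
  have hκ0 : 0 < κ := mul_pos hc (norm_pos_iff.2 hν)
  have hs := strainForm_symbol_le hC h1 h2 ν w
  rw [← mul_pow, ← hκ] at hs
  have p1 := strainForm_nonneg hC x (κ • Z + symbolStrain ν w)
  have p2 := strainForm_nonneg hC x (κ • Z - symbolStrain ν w)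
  simp only [map_add, map_sub, add_apply, sub_apply,
    map_smul, smul_apply, smul_eq_mul,
    strainForm_symm C x (symbolStrain ν w) Z] at p1 p2
  rw [abs_le]
  constructor
  · refine le_of_mul_le_mul_left (a := κ) ?_ hκ0
    nlinarith
  · refine le_of_mul_le_mul_left (a := κ) ?_ hκ0
    nlinarith

theorem continuous_add_smul_bilinear {F₁ F₂ : Type*} [NormedAddCommGroup F₁] [NormedSpace ℝ F₁]
    [NormedAddCommGroup F₂] [NormedSpace ℝ F₂] {f : E3 → F₁ →L[ℝ] F₂ →L[ℝ] ℝ} (hf : Continuous f)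
    {a : E3 → ℝ} (ha : Continuous a) (B : F₁ →L[ℝ] F₂ →L[ℝ] ℝ) :
    Continuous fun x => f x + a x • B :=
  hf.add (ha.smul continuous_const)

theorem continuous_massForm {C : Coeffs} (hC : C.Admissible) : Continuous (massForm C) := by
  obtain ⟨c, hc, h11, h12, h22, hmu, hlam, hq, hr⟩ := hC.nice
  exact continuous_add_smul_bilinear (continuous_add_smul_bilinear
    (h11.contDiff.continuous.smul continuous_const) h12.contDiff.continuous _)
    h22.contDiff.continuous _

theorem continuous_strainForm {C : Coeffs} (hC : C.Admissible) : Continuous (strainForm C) := by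
  obtain ⟨c, hc, h11, h12, h22, hmu, hlam, hq, hr⟩ := hC.nice
  exact continuous_add_smul_bilinear (continuous_add_smul_bilinear (continuous_add_smul_bilinear
    (hlam.contDiff.continuous.smul continuous_const) hq.contDiff.continuous _)
    hr.contDiff.continuous _) hmu.contDiff.continuous _

end

end Biot

/-! ### Bilinear pairings and differentiable curves in L² of a ball. -/

namespace Biot

noncomputable section

/-- Lebesgue measure on the ball of radius `r` around the origin. -/
abbrev ballMeasure (r : ℝ) : Measure E3 := volume.restrict (Metric.ball (0 : E3) r)

section Pairing

variable {F₁ F₂ : Type*} [NormedAddCommGroup F₁] [NormedSpace ℝ F₁]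
  [NormedAddCommGroup F₂] [NormedSpace ℝ F₂]

theorem exists_bound_on_ball {F : Type*} [NormedAddCommGroup F] (r : ℝ) {Q : E3 → F}
    (hQ : Continuous Q) : ∃ K : ℝ, 0 ≤ K ∧ ∀ᵐ x ∂ballMeasure r, ‖Q x‖ ≤ K := by
  obtain ⟨K, hK⟩ := (isCompact_closedBall (0 : E3) r).exists_bound_of_continuousOn hQ.continuousOn
  -- For negative radius the ball is empty and `K` carries no sign.
  refine ⟨max K 0, le_max_right _ _, ?_⟩
  filter_upwards [ae_restrict_mem Metric.isOpen_ball.measurableSet] with x hx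
  exact (hK x (Metric.ball_subset_closedBall hx)).trans (le_max_left _ _)

theorem aestronglyMeasurable_bilin {μ : Measure E3} {Q : E3 → F₁ →L[ℝ] F₂ →L[ℝ] ℝ}
    (hQ : Continuous Q) {f : E3 → F₁} {g : E3 → F₂} (hf : AEStronglyMeasurable f μ)
    (hg : AEStronglyMeasurable g μ) : AEStronglyMeasurable (fun x => Q x (f x) (g x)) μ := by
  have h1 : AEStronglyMeasurable (fun x => Q x (f x)) μ :=
    isBoundedBilinearMap_apply.continuous.comp_aestronglyMeasurable
      (hQ.aestronglyMeasurable.prodMk hf)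
  exact isBoundedBilinearMap_apply.continuous.comp_aestronglyMeasurable (h1.prodMk hg)

theorem norm_bilin_le {B : F₁ →L[ℝ] F₂ →L[ℝ] ℝ} {K : ℝ} (h : ‖B‖ ≤ K) (a : F₁) (b : F₂) :
    ‖B a b‖ ≤ K * (‖a‖ * ‖b‖) := by
  refine (B.le_opNorm₂ a b).trans ?_
  rw [mul_assoc]
  gcongr

theorem integrable_bilin {r : ℝ} {Q : E3 → F₁ →L[ℝ] F₂ →L[ℝ] ℝ} (hQ : Continuous Q)
    {f : E3 → F₁} {g : E3 → F₂} (hf : MemLp f 2 (ballMeasure r))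
    (hg : MemLp g 2 (ballMeasure r)) :
    Integrable (fun x => Q x (f x) (g x)) (ballMeasure r) := by
  obtain ⟨K, hK0, hK⟩ := exists_bound_on_ball r hQ
  refine ((hf.norm.integrable_mul hg.norm).const_mul K).mono'
    (aestronglyMeasurable_bilin hQ hf.1 hg.1) ?_
  filter_upwards [hK] with x hx
  exact norm_bilin_le hx _ _

/-- The bilinear form `(f, g) ↦ ∫ Q x (f x) (g x) dx` on square integrable functions on a ball. -/
def pairing (r : ℝ) (Q : E3 → F₁ →L[ℝ] F₂ →L[ℝ] ℝ) (hQ : Continuous Q) :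
    Lp F₁ 2 (ballMeasure r) →L[ℝ] Lp F₂ 2 (ballMeasure r) →L[ℝ] ℝ :=
  LinearMap.mkContinuous₂ (LinearMap.mk₂ ℝ
    (fun (f : Lp F₁ 2 (ballMeasure r)) (g : Lp F₂ 2 (ballMeasure r)) =>
      ∫ x, Q x (f x) (g x) ∂ballMeasure r)
    (fun f f' g => by
      rw [← integral_add (integrable_bilin hQ (Lp.memLp f) (Lp.memLp g))
        (integrable_bilin hQ (Lp.memLp f') (Lp.memLp g))]
      refine integral_congr_ae ?_
      filter_upwards [Lp.coeFn_add f f'] with x hx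
      rw [hx]
      simp)
    (fun a f g => by
      rw [smul_eq_mul, ← integral_const_mul]
      refine integral_congr_ae ?_
      filter_upwards [Lp.coeFn_smul a f] with x hx
      rw [hx]
      simp)
    (fun f g g' => by
      rw [← integral_add (integrable_bilin hQ (Lp.memLp f) (Lp.memLp g))
        (integrable_bilin hQ (Lp.memLp f) (Lp.memLp g'))]
      refine integral_congr_ae ?_
      filter_upwards [Lp.coeFn_add g g'] with x hx
      rw [hx]
      simp)
    (fun a f g => by
      rw [smul_eq_mul, ← integral_const_mul]
      refine integral_congr_ae ?_
      filter_upwards [Lp.coeFn_smul a g] with x hx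
      rw [hx]
      simp))
    (exists_bound_on_ball r hQ).choose
    (by
      intro f g
      obtain ⟨hK0, hK⟩ := (exists_bound_on_ball r hQ).choose_spec
      set K := (exists_bound_on_ball r hQ).choose
      have hi := ((Lp.memLp f).norm.integrable_mul (Lp.memLp g).norm)
      have h1 : ‖∫ x, Q x (f x) (g x) ∂ballMeasure r‖ ≤
          K * ∫ x, ‖f x‖ * ‖g x‖ ∂ballMeasure r := by
        rw [← integral_const_mul]
        refine norm_integral_le_of_norm_le (hi.const_mul K) ?_
        filter_upwards [hK] with x hx
        exact norm_bilin_le hx _ _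
      have h2 : ∫ x, ‖f x‖ * ‖g x‖ ∂ballMeasure r =
          inner ℝ ((Lp.memLp f).norm.toLp _) ((Lp.memLp g).norm.toLp _) := by
        rw [L2.inner_def]
        refine integral_congr_ae ?_
        filter_upwards [(Lp.memLp f).norm.coeFn_toLp, (Lp.memLp g).norm.coeFn_toLp] with x h h'
        rw [h, h']
        simp [mul_comm]
      have h3 : inner ℝ ((Lp.memLp f).norm.toLp _) ((Lp.memLp g).norm.toLp _) ≤ ‖f‖ * ‖g‖ := by
        refine (real_inner_le_norm _ _).trans (le_of_eq ?_)
        rw [Lp.norm_toLp, Lp.norm_toLp, eLpNorm_norm, eLpNorm_norm, Lp.norm_def, Lp.norm_def]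
      refine h1.trans ?_
      rw [mul_assoc]
      exact mul_le_mul_of_nonneg_left (h2.le.trans h3) hK0)

theorem pairing_apply (r : ℝ) {Q : E3 → F₁ →L[ℝ] F₂ →L[ℝ] ℝ} (hQ : Continuous Q)
    (f : Lp F₁ 2 (ballMeasure r)) (g : Lp F₂ 2 (ballMeasure r)) :
    pairing r Q hQ f g = ∫ x, Q x (f x) (g x) ∂ballMeasure r := rfl

/-- The square integrable function with values `(f x, g x)`. -/
def pairLp {r : ℝ} (f : Lp F₁ 2 (ballMeasure r)) (g : Lp F₂ 2 (ballMeasure r)) :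
    Lp (F₁ × F₂) 2 (ballMeasure r) :=
  (ContinuousLinearMap.inl ℝ F₁ F₂).compLpL 2 (ballMeasure r) f +
    (ContinuousLinearMap.inr ℝ F₁ F₂).compLpL 2 (ballMeasure r) g

theorem coeFn_pairLp {r : ℝ} (f : Lp F₁ 2 (ballMeasure r)) (g : Lp F₂ 2 (ballMeasure r)) :
    pairLp f g =ᵐ[ballMeasure r] fun x => (f x, g x) := by
  filter_upwards [Lp.coeFn_add ((ContinuousLinearMap.inl ℝ F₁ F₂).compLpL 2 (ballMeasure r) f)
    ((ContinuousLinearMap.inr ℝ F₁ F₂).compLpL 2 (ballMeasure r) g),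
    (ContinuousLinearMap.inl ℝ F₁ F₂).coeFn_compLpL (p := 2) (𝕜 := ℝ) f,
    (ContinuousLinearMap.inr ℝ F₁ F₂).coeFn_compLpL (p := 2) (𝕜 := ℝ) g] with x h1 h2 h3
  rw [pairLp, h1, Pi.add_apply, h2, h3]
  simp

theorem continuous_pairLp {r : ℝ} {f : ℝ → Lp F₁ 2 (ballMeasure r)}
    {g : ℝ → Lp F₂ 2 (ballMeasure r)} (hf : Continuous f) (hg : Continuous g) :
    Continuous fun t => pairLp (f t) (g t) :=
  (((ContinuousLinearMap.inl ℝ F₁ F₂).compLpL 2 (ballMeasure r)).continuous.comp hf).add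
    (((ContinuousLinearMap.inr ℝ F₁ F₂).compLpL 2 (ballMeasure r)).continuous.comp hg)

theorem hasDerivAt_pairLp {r t : ℝ} {f : ℝ → Lp F₁ 2 (ballMeasure r)}
    {g : ℝ → Lp F₂ 2 (ballMeasure r)} {f' : Lp F₁ 2 (ballMeasure r)}
    {g' : Lp F₂ 2 (ballMeasure r)} (hf : HasDerivAt f f' t) (hg : HasDerivAt g g' t) :
    HasDerivAt (fun t => pairLp (f t) (g t)) (pairLp f' g') t :=
  (((ContinuousLinearMap.inl ℝ F₁ F₂).compLpL 2 (ballMeasure r)).hasFDerivAt.comp_hasDerivAt t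
    hf).add
    (((ContinuousLinearMap.inr ℝ F₁ F₂).compLpL 2 (ballMeasure r)).hasFDerivAt.comp_hasDerivAt t hg)

end Pairing

/-- A curve in `L²_loc` is continuous in `L²` of every ball. -/
theorem ContL2loc.continuous_toLp {F : Type*} [NormedAddCommGroup F] {f : ℝ → E3 → F}
    (h : ContL2loc f) (r : ℝ) : Continuous fun t => (h.1 t r).toLp (f t) := by
  refine continuous_iff_continuousAt.2 fun t₀ => ?_
  refine (Lp.tendsto_Lp_iff_tendsto_eLpNorm'' (fun t => f t) (fun t => h.1 t r) (f t₀)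
    (h.1 t₀ r)).2 ?_
  exact h.2 r t₀

theorem HasTimeDeriv.hasDerivAt_toLp {f g : ℝ → E3 → E3} (hfg : HasTimeDeriv f g)
    (hf : ∀ t, L2loc (f t)) (hg : ∀ t, L2loc (g t)) (r t : ℝ) :
    HasDerivAt (fun t => (hf t r).toLp (f t)) ((hg t r).toLp (g t)) t := by
  rw [hasDerivAt_iff_tendsto_slope_zero]
  have h1 := hfg r t
  have h2 : ∀ h : ℝ, MemLp (h⁻¹ • (f (t + h) - f t)) 2 (ballMeasure r) := fun h =>
    ((hf (t + h) r).sub (hf t r)).const_smul _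
  have h3 := (Lp.tendsto_Lp_iff_tendsto_eLpNorm'' (fi := 𝓝[≠] (0 : ℝ))
    (fun h : ℝ => h⁻¹ • (f (t + h) - f t)) h2 (g t) (hg t r)).2 h1
  exact h3

end

end Biot

/-! ### The weak formulation integrated once in time. -/

namespace Biot

/-- A continuously differentiable function satisfying `m'' = -s` in the sense of distributions
satisfies the integrated equation. -/
theorem deriv_add_integral_eq {m n s : ℝ → ℝ} (hm : ∀ t, HasDerivAt m (n t) t)
    (hn : Continuous n) (hs : Continuous s)
    (H : ∀ θ : ℝ → ℝ, IsTest θ → ∫ t, (m t * deriv (deriv θ) t + s t * θ t) = 0) (t : ℝ) :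
    n t + ∫ τ in (0 : ℝ)..t, s τ = n 0 := by
  set S : ℝ → ℝ := fun t => ∫ τ in (0 : ℝ)..t, s τ with hS
  have hSd : ∀ t, HasDerivAt S (s t) t := fun t => hs.integral_hasStrictDerivAt 0 t |>.hasDerivAt
  have hSc : Continuous S := continuous_iff_continuousAt.2 fun t => (hSd t).continuousAt
  have hmc : Continuous m := continuous_iff_continuousAt.2 fun t => (hm t).continuousAt
  -- Integrating by parts once in each term shows that m' plus the primitive of s has zero
  -- distributional derivative.
  have key := eq_of_integral_mul_deriv_eq_zero (h := fun t => n t + S t) (hn.add hSc) ?_ t 0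
  · simpa [hS] using key
  intro θ hθ
  have hd : ∀ θ : ℝ → ℝ, IsTest θ → IsTest (deriv θ) := fun θ hθ =>
    ⟨((contDiff_infty_iff_deriv).1 hθ.1).2, hθ.2.deriv⟩
  have hθ1 := hd θ hθ
  have hθ2 := hd _ hθ1
  have hi : ∀ {a b : ℝ → ℝ}, Continuous a → IsTest b → Integrable (a * b) := fun ha hb =>
    (ha.mul hb.1.continuous).integrable_of_hasCompactSupport hb.2.mul_left
  have i1 := integral_mul_deriv_eq_deriv_mul_of_integrable (u := m) (v := deriv θ) (u' := n)
    (v' := deriv (deriv θ)) (fun x _ => hm x) (fun x _ => (hθ1.1.differentiable (by simp) x).hasDerivAt)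
    (hi hmc hθ2) (hi hn hθ1) (hi hmc hθ1)
  have i2 := integral_mul_deriv_eq_deriv_mul_of_integrable (u := S) (v := θ) (u' := s)
    (v' := deriv θ) (fun x _ => hSd x) (fun x _ => (hθ.1.differentiable (by simp) x).hasDerivAt)
    (hi hSc hθ1) (hi hs hθ) (hi hSc hθ)
  have i3 := H θ hθ
  have i4 := integral_add (hi hmc hθ2) (hi hs hθ)
  have i5 := integral_add (hi hn hθ1) (hi hSc hθ1)
  simp only [Pi.mul_apply] at i4 i5
  simp only [add_mul]
  linarith

theorem isTest_smul {θ : ℝ → ℝ} (hθ : IsTest θ) {φ : E3 → E3} (hφ : IsTest φ) :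
    IsTest (Function.uncurry fun t x => θ t • φ x) := by
  refine ⟨(hθ.1.comp contDiff_fst).smul (hφ.1.comp contDiff_snd), ?_⟩
  refine HasCompactSupport.intro (hθ.2.prod hφ.2) ?_
  rintro ⟨t, x⟩ h
  rw [Set.mem_prod, not_and_or] at h
  rcases h with h | h
  · simp [Function.uncurry, image_eq_zero_of_notMem_tsupport h]
  · simp [Function.uncurry, image_eq_zero_of_notMem_tsupport h]

theorem dtt_smul {θ : ℝ → ℝ} (hθ : IsTest θ) (φ : E3 → E3) (t : ℝ) (x : E3) :
    dtt (fun t x => θ t • φ x) t x = deriv (deriv θ) t • φ x := by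
  have h1 : deriv (fun s => θ s • φ x) = fun s => deriv θ s • φ x := by
    funext s
    exact ((hθ.1.differentiable (by simp) s).hasDerivAt.smul_const (φ x)).deriv
  have hθ1 : ContDiff ℝ ∞ (deriv θ) := ((contDiff_infty_iff_deriv).1 hθ.1).2
  rw [dtt, iteratedDeriv_succ, iteratedDeriv_one, h1]
  exact ((hθ1.differentiable (by simp) t).hasDerivAt.smul_const (φ x)).deriv

theorem pd_const_smul {φ : E3 → E3} (hφ : IsTest φ) (c : ℝ) (x : E3) (i j : Fin 3) :
    pd (fun x => c • φ x) x i j = c * pd φ x i j := by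
  rw [pd, pd, fderiv_fun_const_smul (hφ.1.differentiable (by simp) x)]
  simp

theorem IsTest.smul_const {ϕ : E3 → ℝ} (hϕ : IsTest ϕ) (v : E3) : IsTest fun x => ϕ x • v :=
  ⟨hϕ.1.smul contDiff_const, hϕ.2.smul_right⟩

theorem pd_smul_basis {ϕ : E3 → ℝ} (hϕ : IsTest ϕ) (i₀ : Fin 3) (x : E3) (i j : Fin 3) :
    pd (fun x => ϕ x • e i₀) x i j = if i = i₀ then fderiv ℝ ϕ x (e j) else 0 := by
  rw [pd, fderiv_smul_const (hϕ.1.differentiable (by simp) x)]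
  simp [e]

noncomputable section

instance (r : ℝ) : IsFiniteMeasure (ballMeasure r) :=
  ⟨by rw [Measure.restrict_apply_univ]; exact measure_ball_lt_top⟩

theorem memLp_ball {F : Type*} [NormedAddCommGroup F] {f : E3 → F} (hf : Continuous f) (r : ℝ) :
    MemLp f 2 (ballMeasure r) := by
  obtain ⟨K, -, hK⟩ := exists_bound_on_ball r hf
  exact MemLp.of_bound hf.aestronglyMeasurable K hK

theorem continuous_pd {φ : E3 → E3} (hφ : IsTest φ) : Continuous (pd φ) := by
  refine continuous_pi fun i => continuous_pi fun j => ?_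
  exact (EuclideanSpace.proj (𝕜 := ℝ) i).continuous.comp
    ((hφ.1.continuous_fderiv (by simp)).clm_apply continuous_const)

theorem pd_eq_zero {φ : E3 → E3} {x : E3} (hx : x ∉ tsupport φ) : pd φ x = 0 := by
  have : fderiv ℝ φ x = 0 := by
    by_contra h
    exact hx (support_fderiv_subset ℝ h)
  ext i j
  simp [pd, this]

theorem setIntegral_ball_eq {f : E3 → ℝ} {r : ℝ} (hf : ∀ x ∉ Metric.ball (0 : E3) r, f x = 0) :
    ∫ x, f x ∂ballMeasure r = ∫ x, f x :=
  setIntegral_eq_integral_of_forall_compl_eq_zero hf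

/-- The weak formulation, tested with a product `θ(t) (Φ(x), Ψ(x))` and integrated in time. -/
theorem integrated_weak {C : Coeffs} (hC : C.Admissible) {us uf vs vf : ℝ → E3 → E3}
    {G : ℝ → E3 → Fin 3 → Fin 3 → ℝ} {d : ℝ → E3 → ℝ}
    (cus : ContL2loc us) (cuf : ContL2loc uf) (cvs : ContL2loc vs) (cvf : ContL2loc vf)
    (hus : HasTimeDeriv us vs) (huf : HasTimeDeriv uf vf) (cG : ContL2loc G) (cd : ContL2loc d)
    {r : ℝ} {Φ : E3 → VecPair} {Ψ : E3 → Strain} (hΦ : MemLp Φ 2 (ballMeasure r))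
    (hΨ : MemLp Ψ 2 (ballMeasure r)) (hΦ0 : ∀ x ∉ Metric.ball (0 : E3) r, Φ x = 0)
    (hΨ0 : ∀ x ∉ Metric.ball (0 : E3) r, Ψ x = 0)
    (H : ∀ θ : ℝ → ℝ, IsTest θ → ∫ t, ∫ x, (deriv (deriv θ) t *
      massForm C x (us t x, uf t x) (Φ x) + θ t * strainForm C x (G t x, d t x) (Ψ x)) = 0)
    (t : ℝ) :
    pairing r (massForm C) (continuous_massForm hC)
        (pairLp ((cvs.1 t r).toLp (vs t)) ((cvf.1 t r).toLp (vf t))) (hΦ.toLp Φ) +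
      pairing r (strainForm C) (continuous_strainForm hC)
        (∫ τ in (0 : ℝ)..t, pairLp ((cG.1 τ r).toLp (G τ)) ((cd.1 τ r).toLp (d τ)))
        (hΨ.toLp Ψ) =
    pairing r (massForm C) (continuous_massForm hC)
        (pairLp ((cvs.1 0 r).toLp (vs 0)) ((cvf.1 0 r).toLp (vf 0))) (hΦ.toLp Φ) := by
  set U := fun t => pairLp ((cus.1 t r).toLp (us t)) ((cuf.1 t r).toLp (uf t)) with hU
  set V := fun t => pairLp ((cvs.1 t r).toLp (vs t)) ((cvf.1 t r).toLp (vf t)) with hV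
  set Y := fun t => pairLp ((cG.1 t r).toLp (G t)) ((cd.1 t r).toLp (d t)) with hY
  have hUd : ∀ t, HasDerivAt U (V t) t := fun t =>
    hasDerivAt_pairLp (hus.hasDerivAt_toLp cus.1 cvs.1 r t) (huf.hasDerivAt_toLp cuf.1 cvf.1 r t)
  have hVc : Continuous V := continuous_pairLp (cvs.continuous_toLp r) (cvf.continuous_toLp r)
  have hYc : Continuous Y := continuous_pairLp (cG.continuous_toLp r) (cd.continuous_toLp r)
  set LM := (pairing r (massForm C) (continuous_massForm hC)).flip (hΦ.toLp Φ) with hLM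
  set LS := (pairing r (strainForm C) (continuous_strainForm hC)).flip (hΨ.toLp Ψ) with hLS
  -- For a fixed spatial test pair, both pairings are continuous linear functionals on L², so the
  -- vector curves become scalar functions and U' = V passes through.
  have key := deriv_add_integral_eq (m := fun t => LM (U t)) (n := fun t => LM (V t))
    (s := fun t => LS (Y t)) (fun t => LM.hasFDerivAt.comp_hasDerivAt t (hUd t))
    (LM.continuous.comp hVc) (LS.continuous.comp hYc) ?_ t
  · rw [LS.intervalIntegral_comp_comm (hYc.intervalIntegrable 0 t)] at key
    exact key
  intro θ hθ
  rw [← H θ hθ]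
  congr 1
  funext t
  have eM : LM (U t) = ∫ x, massForm C x (us t x, uf t x) (Φ x) ∂ballMeasure r := by
    refine integral_congr_ae ?_
    filter_upwards [coeFn_pairLp ((cus.1 t r).toLp (us t)) ((cuf.1 t r).toLp (uf t)),
      (cus.1 t r).coeFn_toLp, (cuf.1 t r).coeFn_toLp, hΦ.coeFn_toLp] with x h1 h2 h3 h4
    simp only [hU, h1, h2, h3, h4]
  have eS : LS (Y t) = ∫ x, strainForm C x (G t x, d t x) (Ψ x) ∂ballMeasure r := by
    refine integral_congr_ae ?_
    filter_upwards [coeFn_pairLp ((cG.1 t r).toLp (G t)) ((cd.1 t r).toLp (d t)),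
      (cG.1 t r).coeFn_toLp, (cd.1 t r).coeFn_toLp, hΨ.coeFn_toLp] with x h1 h2 h3 h4
    simp only [hY, h1, h2, h3, h4]
  have mU : MemLp (fun x => (us t x, uf t x)) 2 (ballMeasure r) := by
    refine (memLp_congr_ae ?_).1 (Lp.memLp (U t))
    filter_upwards [coeFn_pairLp ((cus.1 t r).toLp (us t)) ((cuf.1 t r).toLp (uf t)),
      (cus.1 t r).coeFn_toLp, (cuf.1 t r).coeFn_toLp] with x h1 h2 h3
    simp only [hU, h1, h2, h3]
  have mY : MemLp (fun x => (G t x, d t x)) 2 (ballMeasure r) := by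
    refine (memLp_congr_ae ?_).1 (Lp.memLp (Y t))
    filter_upwards [coeFn_pairLp ((cG.1 t r).toLp (G t)) ((cd.1 t r).toLp (d t)),
      (cG.1 t r).coeFn_toLp, (cd.1 t r).coeFn_toLp] with x h1 h2 h3
    simp only [hY, h1, h2, h3]
  rw [← setIntegral_ball_eq (r := r), integral_add, integral_const_mul, integral_const_mul, eM, eS]
  · ring
  · exact (integrable_bilin (continuous_massForm hC) mU hΦ).const_mul _
  · exact (integrable_bilin (continuous_strainForm hC) mY hΨ).const_mul _
  · intro x hx
    simp [hΦ0 x hx, hΨ0 x hx]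

/-- The test pair for the first equation. -/
theorem weak_solid {C : Coeffs} {us uf : ℝ → E3 → E3} {G : ℝ → E3 → Fin 3 → Fin 3 → ℝ}
    {d : ℝ → E3 → ℝ} (H : ∀ w : ℝ → E3 → E3, IsTest (Function.uncurry w) →
      ∫ t, ∫ x, (inner ℝ (C.rho11 x • us t x + C.rho12 x • uf t x) (dtt w t x) +
        ∑ i, ∑ j, stress C x (G t x) (d t x) i j * pd (w t) x i j) = 0)
    {φ : E3 → E3} (hφ : IsTest φ) {θ : ℝ → ℝ} (hθ : IsTest θ) :
    ∫ t, ∫ x, (deriv (deriv θ) t * massForm C x (us t x, uf t x) (φ x, 0) +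
      θ t * strainForm C x (G t x, d t x) (pd φ x, 0)) = 0 := by
  refine Eq.trans ?_ (H _ (isTest_smul hθ hφ))
  congr 1
  funext t
  congr 1
  funext x
  rw [dtt_smul hθ, ← sum_stress_mul, massForm_apply]
  simp only [pd_const_smul hφ, inner_smul_right, inner_add_left, real_inner_smul_left,
    inner_zero_right, Finset.mul_sum]
  congr 1
  · ring
  · refine Finset.sum_congr rfl fun i _ => Finset.sum_congr rfl fun j _ => ?_
    ring

/-- The test pair for the second equation. -/
theorem weak_fluid {C : Coeffs} {us uf : ℝ → E3 → E3} {G : ℝ → E3 → Fin 3 → Fin 3 → ℝ}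
    {d : ℝ → E3 → ℝ} (H : ∀ w : ℝ → E3 → E3, IsTest (Function.uncurry w) →
      ∫ t, ∫ x, (inner ℝ (C.rho12 x • us t x + C.rho22 x • uf t x) (dtt w t x) -
        pressure C x (G t x) (d t x) * tr3 (pd (w t) x)) = 0)
    {φ : E3 → E3} (hφ : IsTest φ) {θ : ℝ → ℝ} (hθ : IsTest θ) :
    ∫ t, ∫ x, (deriv (deriv θ) t * massForm C x (us t x, uf t x) (0, φ x) +
      θ t * strainForm C x (G t x, d t x) (0, tr3 (pd φ x))) = 0 := by
  refine Eq.trans ?_ (H _ (isTest_smul hθ hφ))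
  congr 1
  funext t
  congr 1
  funext x
  rw [dtt_smul hθ, ← neg_pressure_mul, massForm_apply]
  simp only [tr3, pd_const_smul hφ, inner_smul_right, inner_add_left, real_inner_smul_left,
    inner_zero_right, ← Finset.mul_sum]
  ring

end

end Biot

/-! ### The local energy balance with a cutoff. -/

namespace Biot

noncomputable section

/-- The gradient vector of a scalar function. -/
def gradVec (g : E3 → ℝ) (x : E3) : E3 := (InnerProductSpace.toDual ℝ E3).symm (fderiv ℝ g x)

theorem gradVec_apply (g : E3 → ℝ) (x : E3) (j : Fin 3) :
    gradVec g x j = fderiv ℝ g x (e j) := by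
  have h : inner ℝ (gradVec g x) (e j) = fderiv ℝ g x (e j) :=
    InnerProductSpace.toDual_symm_apply
  rw [← h]
  simp [e, EuclideanSpace.inner_single_right]

theorem norm_gradVec (g : E3 → ℝ) (x : E3) : ‖gradVec g x‖ = ‖fderiv ℝ g x‖ := by
  simp [gradVec]

theorem IsTest.mul {g θ : E3 → ℝ} (hg : IsTest g) (hθ : IsTest θ) : IsTest fun x => g x * θ x :=
  ⟨hg.1.mul hθ.1, hg.2.mul_right⟩

theorem IsTest.exists_bound {F : Type*} [NormedAddCommGroup F] [NormedSpace ℝ F] {g : E3 → F}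
    (hg : IsTest g) : ∃ K, ∀ x, ‖g x‖ ≤ K :=
  hg.2.exists_bound_of_continuous hg.1.continuous

theorem IsTest.fderiv_apply {g : E3 → ℝ} (hg : IsTest g) (v : E3) :
    IsTest fun x => fderiv ℝ g x v :=
  ⟨(hg.1.fderiv_right (by simp)).clm_apply contDiff_const, hg.2.fderiv_apply ℝ v⟩

theorem IsTest.memLp_mul {g f : E3 → ℝ} (hg : IsTest g) (hf : MemLp f 2 volume) :
    MemLp (fun x => g x * f x) 2 volume := by
  obtain ⟨K, hK⟩ := hg.exists_bound
  refine hf.of_le_mul (c := K) (hg.1.continuous.aestronglyMeasurable.mul hf.1)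
    (Eventually.of_forall fun x => ?_)
  rw [norm_mul]
  exact mul_le_mul_of_nonneg_right (hK x) (norm_nonneg _)

theorem fderiv_mul_apply {g θ : E3 → ℝ} (hg : IsTest g) (hθ : IsTest θ) (x v : E3) :
    fderiv ℝ (fun x => g x * θ x) x v = g x * fderiv ℝ θ x v + fderiv ℝ g x v * θ x := by
  rw [fderiv_fun_mul (hg.1.differentiable (by simp) x) (hθ.1.differentiable (by simp) x)]
  simp [mul_comm]

theorem memLp_fst {F₁ F₂ : Type*} [NormedAddCommGroup F₁] [NormedAddCommGroup F₂]
    {f : E3 → F₁ × F₂} {μ : Measure E3} (hf : MemLp f 2 μ) : MemLp (fun x => (f x).1) 2 μ :=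
  hf.of_le (continuous_fst.comp_aestronglyMeasurable hf.1)
    (Eventually.of_forall fun _ => norm_fst_le _)

theorem memLp_snd {F₁ F₂ : Type*} [NormedAddCommGroup F₁] [NormedAddCommGroup F₂]
    {f : E3 → F₁ × F₂} {μ : Measure E3} (hf : MemLp f 2 μ) : MemLp (fun x => (f x).2) 2 μ :=
  hf.of_le (continuous_snd.comp_aestronglyMeasurable hf.1)
    (Eventually.of_forall fun _ => norm_snd_le _)

theorem memLp_coord {f : E3 → E3} {μ : Measure E3} (hf : MemLp f 2 μ) (i : Fin 3) :
    MemLp (fun x => f x i) 2 μ :=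
  hf.of_le ((EuclideanSpace.proj (𝕜 := ℝ) i).continuous.comp_aestronglyMeasurable hf.1)
    (Eventually.of_forall fun _ => PiLp.norm_apply_le _ i)

theorem memLp_entry {f : E3 → Fin 3 → Fin 3 → ℝ} {μ : Measure E3} (hf : MemLp f 2 μ)
    (i j : Fin 3) : MemLp (fun x => f x i j) 2 μ :=
  hf.of_le ((continuous_apply_apply i j).comp_aestronglyMeasurable hf.1)
    (Eventually.of_forall fun x => (norm_le_pi_norm (f x i) j).trans (norm_le_pi_norm (f x) i))

/-- A continuous coefficient times a function supported in a ball is square integrable. -/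
theorem memLp_bilin_const {F₁ F₂ : Type*} [NormedAddCommGroup F₁] [NormedSpace ℝ F₁]
    [NormedAddCommGroup F₂] [NormedSpace ℝ F₂] {Q : E3 → F₁ →L[ℝ] F₂ →L[ℝ] ℝ}
    (hQ : Continuous Q) {f : E3 → F₁} (hf : MemLp f 2 volume) {r : ℝ}
    (hf0 : ∀ x ∉ Metric.ball (0 : E3) r, f x = 0) (b : F₂) :
    MemLp (fun x => Q x (f x) b) 2 volume := by
  obtain ⟨K, hK⟩ := (isCompact_closedBall (0 : E3) r).exists_bound_of_continuousOn hQ.continuousOn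
  refine hf.of_le_mul (c := K * ‖b‖) (aestronglyMeasurable_bilin hQ hf.1 aestronglyMeasurable_const)
    (Eventually.of_forall fun x => ?_)
  by_cases hx : x ∈ Metric.ball (0 : E3) r
  · have := norm_bilin_le (hK x (Metric.ball_subset_closedBall hx)) (f x) b
    linarith
  · simp [hf0 x hx]

/-- Multiplication by a test function keeps weak derivatives. -/
theorem integral_mul_test_fderiv {U : Set E3} {a D : E3 → ℝ} (ha : MemLp a 2 volume)
    (hD : MemLp D 2 volume) {v : E3}
    (h : ∀ ϕ : E3 → ℝ, IsTest ϕ → tsupport ϕ ⊆ U →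
      ∫ x, a x * fderiv ℝ ϕ x v = -∫ x, D x * ϕ x)
    {g : E3 → ℝ} (hg : IsTest g) (hgU : tsupport g ⊆ U) {θ : E3 → ℝ} (hθ : IsTest θ) :
    ∫ x, g x * a x * fderiv ℝ θ x v = -∫ x, (g x * D x + fderiv ℝ g x v * a x) * θ x := by
  have h1 := h _ (hg.mul hθ) ((tsupport_mul_subset_left).trans hgU)
  have it : ∀ {ϕ : E3 → ℝ}, IsTest ϕ → MemLp ϕ 2 volume := fun hϕ =>
    hϕ.1.continuous.memLp_of_hasCompactSupport hϕ.2
  have i1 : Integrable fun x => g x * a x * fderiv ℝ θ x v :=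
    (hg.memLp_mul ha).integrable_mul (it (hθ.fderiv_apply v))
  have i2 : Integrable fun x => fderiv ℝ g x v * a x * θ x :=
    ((hg.fderiv_apply v).memLp_mul ha).integrable_mul (it hθ)
  have i3 : Integrable fun x => g x * D x * θ x := (hg.memLp_mul hD).integrable_mul (it hθ)
  have e1 : ∫ x, a x * fderiv ℝ (fun x => g x * θ x) x v =
      (∫ x, g x * a x * fderiv ℝ θ x v) + ∫ x, fderiv ℝ g x v * a x * θ x := by
    rw [← integral_add i1 i2]
    congr 1
    funext x
    rw [fderiv_mul_apply hg hθ]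
    ring
  have e2 : ∫ x, (g x * D x + fderiv ℝ g x v * a x) * θ x =
      (∫ x, g x * D x * θ x) + ∫ x, fderiv ℝ g x v * a x * θ x := by
    rw [← integral_add i3 i2]
    congr 1
    funext x
    ring
  have e3 : ∫ x, D x * (g x * θ x) = ∫ x, g x * D x * θ x := by
    congr 1
    funext x
    ring
  rw [e1, e3] at h1
  rw [e2]
  linarith

/-- The vector version of `integral_mul_test_fderiv` for the divergence. -/
theorem sum_integral_mul_test_fderiv {U : Set E3} {a : Fin 3 → E3 → ℝ} {D : E3 → ℝ}
    (ha : ∀ i, MemLp (a i) 2 volume) (hD : MemLp D 2 volume)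
    (h : ∀ ϕ : E3 → ℝ, IsTest ϕ → tsupport ϕ ⊆ U →
      ∑ i, ∫ x, a i x * fderiv ℝ ϕ x (e i) = -∫ x, D x * ϕ x)
    {g : E3 → ℝ} (hg : IsTest g) (hgU : tsupport g ⊆ U) {θ : E3 → ℝ} (hθ : IsTest θ) :
    ∑ i, ∫ x, g x * a i x * fderiv ℝ θ x (e i) =
      -∫ x, (g x * D x + ∑ i, fderiv ℝ g x (e i) * a i x) * θ x := by
  have h1 := h _ (hg.mul hθ) ((tsupport_mul_subset_left).trans hgU)
  have it : ∀ {ϕ : E3 → ℝ}, IsTest ϕ → MemLp ϕ 2 volume := fun hϕ =>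
    hϕ.1.continuous.memLp_of_hasCompactSupport hϕ.2
  have i1 : ∀ i, Integrable fun x => g x * a i x * fderiv ℝ θ x (e i) := fun i =>
    (hg.memLp_mul (ha i)).integrable_mul (it (hθ.fderiv_apply _))
  have i2 : ∀ i, Integrable fun x => fderiv ℝ g x (e i) * a i x * θ x := fun i =>
    ((hg.fderiv_apply _).memLp_mul (ha i)).integrable_mul (it hθ)
  have i3 : Integrable fun x => g x * D x * θ x := (hg.memLp_mul hD).integrable_mul (it hθ)
  have e1 : ∀ i, ∫ x, a i x * fderiv ℝ (fun x => g x * θ x) x (e i) =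
      (∫ x, g x * a i x * fderiv ℝ θ x (e i)) + ∫ x, fderiv ℝ g x (e i) * a i x * θ x := by
    intro i
    rw [← integral_add (i1 i) (i2 i)]
    congr 1
    funext x
    rw [fderiv_mul_apply hg hθ]
    ring
  have e2 : ∫ x, (g x * D x + ∑ i, fderiv ℝ g x (e i) * a i x) * θ x =
      (∫ x, g x * D x * θ x) + ∑ i, ∫ x, fderiv ℝ g x (e i) * a i x * θ x := by
    rw [← integral_finsetSum _ (fun i _ => i2 i), ← integral_add i3]
    · congr 1
      funext x
      rw [add_mul, Finset.sum_mul]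
    · exact integrable_finsetSum _ fun i _ => i2 i
  have e3 : ∫ x, D x * (g x * θ x) = ∫ x, g x * D x * θ x := by
    congr 1
    funext x
    ring
  rw [e3] at h1
  simp only [e1] at h1
  rw [Finset.sum_add_distrib] at h1
  rw [e2]
  linarith

/-- Splitting into scalar components lets the scalar mollification lemmas be applied entry by entry.
-/
theorem massForm_eq_sum (C : Coeffs) (x : E3) (v w : VecPair) :
    massForm C x v w = ∑ i, massForm C x v (e i, 0) * w.1 i +
      ∑ i, massForm C x v (0, e i) * w.2 i := by
  simp [massForm_apply, e, PiLp.inner_apply, Fin.sum_univ_three]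
  ring

theorem strainForm_eq_sum (C : Coeffs) (x : E3) (v w : Strain) :
    strainForm C x v w =
      ∑ i, ∑ j, strainForm C x v (Pi.single i (Pi.single j 1), 0) * w.1 i j +
      strainForm C x v (0, 1) * w.2 := by
  simp [strainForm_apply, Fin.sum_univ_three, tr3, Pi.single_apply]
  ring

/-- Testing the equations with a cutoff times a field of finite energy. -/
theorem energy_balance {C : Coeffs} (hC : C.Admissible) {r : ℝ} {U : Set E3} (hU : IsOpen U)
    {w w' : E3 → VecPair} {z y : E3 → Strain} (hw : MemLp w 2 volume) (hw' : MemLp w' 2 volume)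
    (hz : MemLp z 2 volume) (hy : MemLp y 2 volume)
    (hw'0 : ∀ x ∉ Metric.ball (0 : E3) r, w' x = 0) (hz0 : ∀ x ∉ Metric.ball (0 : E3) r, z x = 0)
    (hs : ∀ i, ∀ ϕ : E3 → ℝ, IsTest ϕ → tsupport ϕ ⊆ U →
      (∫ x, massForm C x (w' x) (ϕ x • e i, 0)) +
        ∫ x, strainForm C x (z x) (pd (fun x => ϕ x • e i) x, 0) = 0)
    (hf : ∀ i, ∀ ϕ : E3 → ℝ, IsTest ϕ → tsupport ϕ ⊆ U →
      (∫ x, massForm C x (w' x) (0, ϕ x • e i)) +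
        ∫ x, strainForm C x (z x) (0, tr3 (pd (fun x => ϕ x • e i) x)) = 0)
    (hgrad : ∀ i j, ∀ ϕ : E3 → ℝ, IsTest ϕ → tsupport ϕ ⊆ U →
      ∫ x, (w x).1 i * fderiv ℝ ϕ x (e j) = -∫ x, (y x).1 i j * ϕ x)
    (hdiv : ∀ ϕ : E3 → ℝ, IsTest ϕ → tsupport ϕ ⊆ U →
      ∑ i, ∫ x, (w x).2 i * fderiv ℝ ϕ x (e i) = -∫ x, (y x).2 * ϕ x)
    {g : E3 → ℝ} (hg : IsTest g) (hgU : tsupport g ⊆ U) :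
    (∫ x, g x * massForm C x (w' x) (w x)) + ∫ x, g x * strainForm C x (z x) (y x) =
      -∫ x, strainForm C x (z x) (symbolStrain (gradVec g x) (w x)) := by
  have cM := continuous_massForm hC
  have cS := continuous_strainForm hC
  set A : Fin 3 → E3 → ℝ := fun i x => massForm C x (w' x) (e i, 0) with hA
  set B : Fin 3 → E3 → ℝ := fun i x => massForm C x (w' x) (0, e i) with hB
  set T : Fin 3 → Fin 3 → E3 → ℝ := fun i j x =>
    strainForm C x (z x) (Pi.single i (Pi.single j 1), 0) with hT
  set P : E3 → ℝ := fun x => strainForm C x (z x) (0, 1) with hP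
  -- The coefficients may grow at infinity; vanishing of `w'` and `z` outside a ball keeps the
  -- products square integrable.
  have mA : ∀ i, MemLp (A i) 2 volume := fun i => memLp_bilin_const cM hw' hw'0 _
  have mB : ∀ i, MemLp (B i) 2 volume := fun i => memLp_bilin_const cM hw' hw'0 _
  have mT : ∀ i j, MemLp (T i j) 2 volume := fun i j => memLp_bilin_const cS hz hz0 _
  have mP : MemLp P 2 volume := memLp_bilin_const cS hz hz0 _
  have mw1 : ∀ i, MemLp (fun x => (w x).1 i) 2 volume := fun i => memLp_coord (memLp_fst hw) i
  have mw2 : ∀ i, MemLp (fun x => (w x).2 i) 2 volume := fun i => memLp_coord (memLp_snd hw) i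
  have my1 : ∀ i j, MemLp (fun x => (y x).1 i j) 2 volume := fun i j =>
    memLp_entry (memLp_fst hy) i j
  have my2 : MemLp (fun x => (y x).2) 2 volume := memLp_snd hy
  have it : ∀ {ϕ : E3 → ℝ}, IsTest ϕ → MemLp ϕ 2 volume := fun hϕ =>
    hϕ.1.continuous.memLp_of_hasCompactSupport hϕ.2
  have hg0 : ∀ x ∉ tsupport g, g x = 0 := fun x hx => image_eq_zero_of_notMem_tsupport hx
  have mD : ∀ i j, MemLp (fun x => g x * (y x).1 i j + fderiv ℝ g x (e j) * (w x).1 i) 2 volume :=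
    fun i j => (hg.memLp_mul (my1 i j)).add ((hg.fderiv_apply _).memLp_mul (mw1 i))
  have md : MemLp (fun x => g x * (y x).2 + ∑ i, fderiv ℝ g x (e i) * (w x).2 i) 2 volume :=
    (hg.memLp_mul my2).add (memLp_finsetSum _ fun i _ => (hg.fderiv_apply _).memLp_mul (mw2 i))
  -- The solid equation is tested with a component of g·w, which is not smooth but has a square
  -- integrable weak gradient: the strain times g plus a term with ∇g.
  have solid : ∀ i, (∫ x, A i x * (g x * (w x).1 i)) +
      ∑ j, ∫ x, T i j x * (g x * (y x).1 i j + fderiv ℝ g x (e j) * (w x).1 i) = 0 := by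
    intro i
    refine integral_add_eq_zero_of_weakGrad hU hg.2 hgU (mA i) (mT i) ?_ (hg.memLp_mul (mw1 i))
      (mD i) (fun x hx => by simp [hg0 x hx]) fun j θ hθ =>
        integral_mul_test_fderiv (mw1 i) (my1 i j) (hgrad i j) hg hgU hθ
    intro ϕ hϕ hϕU
    rw [← hs i ϕ hϕ hϕU, ← integral_finsetSum]
    · congr 1
      · congr 1
        funext x
        rw [massForm_eq_sum C x _ (ϕ x • e i, 0)]
        simp [e, A]
      · congr 1
        funext x
        rw [strainForm_eq_sum C x _ (pd (fun x => ϕ x • e i) x, 0)]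
        simp [pd_smul_basis hϕ, T]
    · intro j _
      exact (mT i j).integrable_mul (it (hϕ.fderiv_apply _))
  -- For the fluid only the divergence of g·w is controlled, and only the divergence is paired with
  -- the pressure.
  have fluid : (∑ i, ∫ x, B i x * (g x * (w x).2 i)) +
      ∫ x, P x * (g x * (y x).2 + ∑ i, fderiv ℝ g x (e i) * (w x).2 i) = 0 := by
    refine integral_add_eq_zero_of_weakDiv hU hg.2 hgU mB mP ?_ (fun i => hg.memLp_mul (mw2 i))
      md (fun i x hx => by simp [hg0 x hx]) fun θ hθ =>
        sum_integral_mul_test_fderiv mw2 my2 hdiv hg hgU hθ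
    intro i ϕ hϕ hϕU
    rw [← hf i ϕ hϕ hϕU]
    congr 1
    · congr 1
      funext x
      rw [massForm_eq_sum C x _ (0, ϕ x • e i)]
      simp [e, B]
    · congr 1
      funext x
      rw [strainForm_eq_sum C x _ (0, tr3 (pd (fun x => ϕ x • e i) x))]
      simp [pd_smul_basis hϕ, P, tr3]
  have iA : ∀ i, Integrable fun x => A i x * (g x * (w x).1 i) := fun i =>
    (mA i).integrable_mul (hg.memLp_mul (mw1 i))
  have iB : ∀ i, Integrable fun x => B i x * (g x * (w x).2 i) := fun i =>
    (mB i).integrable_mul (hg.memLp_mul (mw2 i))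
  have iT1 : ∀ i j, Integrable fun x => T i j x * (g x * (y x).1 i j) := fun i j =>
    (mT i j).integrable_mul (hg.memLp_mul (my1 i j))
  have iT2 : ∀ i j, Integrable fun x => T i j x * (fderiv ℝ g x (e j) * (w x).1 i) := fun i j =>
    (mT i j).integrable_mul ((hg.fderiv_apply _).memLp_mul (mw1 i))
  have iP1 : Integrable fun x => P x * (g x * (y x).2) := mP.integrable_mul (hg.memLp_mul my2)
  have iP2 : ∀ i, Integrable fun x => P x * (fderiv ℝ g x (e i) * (w x).2 i) := fun i =>
    mP.integrable_mul ((hg.fderiv_apply _).memLp_mul (mw2 i))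
  have kin : ∫ x, g x * massForm C x (w' x) (w x) =
      (∑ i, ∫ x, A i x * (g x * (w x).1 i)) + ∑ i, ∫ x, B i x * (g x * (w x).2 i) := by
    rw [← integral_finsetSum _ fun i _ => iA i, ← integral_finsetSum _ fun i _ => iB i,
      ← integral_add (integrable_finsetSum _ fun i _ => iA i)
        (integrable_finsetSum _ fun i _ => iB i)]
    congr 1
    funext x
    rw [massForm_eq_sum C x (w' x) (w x), mul_add, Finset.mul_sum, Finset.mul_sum]
    congr 1
    · exact Finset.sum_congr rfl fun i _ => by simp only [A]; ring
    · exact Finset.sum_congr rfl fun i _ => by simp only [B]; ring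
  have pot : ∫ x, g x * strainForm C x (z x) (y x) =
      (∑ i, ∑ j, ∫ x, T i j x * (g x * (y x).1 i j)) + ∫ x, P x * (g x * (y x).2) := by
    simp only [← integral_finsetSum _ fun j _ => iT1 _ j]
    rw [← integral_finsetSum _ fun i _ => integrable_finsetSum _ fun j _ => iT1 i j,
      ← integral_add (integrable_finsetSum _ fun i _ => integrable_finsetSum _ fun j _ => iT1 i j)
        iP1]
    congr 1
    funext x
    rw [strainForm_eq_sum C x (z x) (y x), mul_add, Finset.mul_sum]
    simp only [Finset.mul_sum]
    congr 1
    · exact Finset.sum_congr rfl fun i _ => Finset.sum_congr rfl fun j _ => by simp only [T]; ring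
    · simp only [P]; ring
  -- The terms in which the derivative falls on the cutoff form the symbol of `w` at ∇g.
  have flux : ∫ x, strainForm C x (z x) (symbolStrain (gradVec g x) (w x)) =
      (∑ i, ∑ j, ∫ x, T i j x * (fderiv ℝ g x (e j) * (w x).1 i)) +
        ∑ i, ∫ x, P x * (fderiv ℝ g x (e i) * (w x).2 i) := by
    simp only [← integral_finsetSum _ fun j _ => iT2 _ j]
    rw [← integral_finsetSum _ fun i _ => integrable_finsetSum _ fun j _ => iT2 i j,
      ← integral_finsetSum _ fun i _ => iP2 i,
      ← integral_add (integrable_finsetSum _ fun i _ => integrable_finsetSum _ fun j _ => iT2 i j)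
        (integrable_finsetSum _ fun i _ => iP2 i)]
    congr 1
    funext x
    rw [strainForm_eq_sum C x (z x) _]
    simp only [symbolStrain, gradVec_apply, Finset.mul_sum]
    congr 1
    · exact Finset.sum_congr rfl fun i _ => Finset.sum_congr rfl fun j _ => by simp only [T]; ring
    · exact Finset.sum_congr rfl fun i _ => by simp only [P]; ring
  have solid' : ∀ i, (∫ x, A i x * (g x * (w x).1 i)) +
      ((∑ j, ∫ x, T i j x * (g x * (y x).1 i j)) +
        ∑ j, ∫ x, T i j x * (fderiv ℝ g x (e j) * (w x).1 i)) = 0 := by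
    intro i
    rw [← solid i, ← Finset.sum_add_distrib]
    congr 1
    refine Finset.sum_congr rfl fun j _ => ?_
    rw [← integral_add (iT1 i j) (iT2 i j)]
    simp only [mul_add]
  have fluid' : (∑ i, ∫ x, B i x * (g x * (w x).2 i)) +
      ((∫ x, P x * (g x * (y x).2)) + ∑ i, ∫ x, P x * (fderiv ℝ g x (e i) * (w x).2 i)) = 0 := by
    rw [← fluid, ← integral_finsetSum _ fun i _ => iP2 i,
      ← integral_add iP1 (integrable_finsetSum _ fun i _ => iP2 i)]
    simp only [mul_add, Finset.mul_sum]
  have h0 := Finset.sum_eq_zero fun i (_ : i ∈ Finset.univ) => solid' i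
  rw [Finset.sum_add_distrib, Finset.sum_add_distrib] at h0
  rw [kin, pot, flux]
  linarith

end

end Biot

/-! ### Exponential weights and Gronwall's inequality. -/

namespace Biot

noncomputable section

/-- A smooth substitute for the distance to `x₀`. -/
def smoothDist (δ : ℝ) (x₀ x : E3) : ℝ := √(δ ^ 2 + ‖x - x₀‖ ^ 2)

theorem contDiff_smoothDist {δ : ℝ} (hδ : 0 < δ) (x₀ : E3) : ContDiff ℝ ∞ (smoothDist δ x₀) := by
  refine ContDiff.sqrt ?_ fun x => by positivity
  exact contDiff_const.add ((contDiff_id.sub contDiff_const).norm_sq ℝ)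

theorem dist_le_smoothDist (δ : ℝ) (x₀ x : E3) : ‖x - x₀‖ ≤ smoothDist δ x₀ x :=
  Real.le_sqrt_of_sq_le (by nlinarith [sq_nonneg δ])

theorem norm_fderiv_smoothDist_le {δ : ℝ} (hδ : 0 < δ) (x₀ x : E3) :
    ‖fderiv ℝ (smoothDist δ x₀) x‖ ≤ 1 := by
  have hpos : 0 < smoothDist δ x₀ x := Real.sqrt_pos.2 (by positivity)
  have h1 : HasFDerivAt (fun x => δ ^ 2 + ‖x - x₀‖ ^ 2) (2 • (innerSL ℝ (x - x₀))) x := by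
    have := (((hasFDerivAt_id x).sub_const x₀).norm_sq).const_add (δ ^ 2)
    simpa using this
  have h2 := (h1.sqrt (by positivity)).fderiv
  change fderiv ℝ (smoothDist δ x₀) x = _ at h2
  rw [h2]
  refine ContinuousLinearMap.opNorm_le_bound _ zero_le_one fun v => ?_
  have h3 := abs_real_inner_le_norm (x - x₀) v
  have h4 := dist_le_smoothDist δ x₀ x
  change 0 < √(δ ^ 2 + ‖x - x₀‖ ^ 2) at hpos
  change ‖x - x₀‖ ≤ √(δ ^ 2 + ‖x - x₀‖ ^ 2) at h4
  generalize √(δ ^ 2 + ‖x - x₀‖ ^ 2) = s at *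
  simp only [smul_apply, innerSL_apply_apply, nsmul_eq_mul, smul_eq_mul, Nat.cast_ofNat,
    Real.norm_eq_abs, one_mul]
  rw [show 1 / (2 * s) * (2 * inner ℝ (x - x₀) v) = inner ℝ (x - x₀) v / s by field_simp,
    abs_div, abs_of_pos hpos, div_le_iff₀ hpos]
  nlinarith [norm_nonneg v]

/-- Localised exponential weights whose gradient is controlled by the weight itself up to a much
smaller error. -/
theorem exists_weight (x₀ : E3) {τ b : ℝ} (hτ : 0 ≤ τ) (hb : τ < b) :
    ∃ L δ β : ℝ, 0 ≤ L ∧ 0 < δ ∧ 0 < β ∧ ∀ k : ℝ, 0 ≤ k → ∃ g : E3 → ℝ, IsTest g ∧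
      tsupport g ⊆ Metric.ball x₀ b ∧ (∀ x, 0 ≤ g x) ∧
      (∀ x, ‖fderiv ℝ g x‖ ≤ L * Real.exp (-(k * (τ + 2 * β))) + k * g x) ∧
      ∀ x ∈ Metric.ball x₀ δ, Real.exp (-(k * β)) ≤ g x := by
  -- The gap between τ and b is cut into four: χ is 1 up to τ + 2β and is supported up to τ + 3β <
  -- b. Neither χ nor the bound `L` for its gradient depends on k.
  set β := (b - τ) / 4 with hβ
  have hβ0 : 0 < β := by rw [hβ]; linarith
  let χ : ContDiffBump x₀ := ⟨τ + 2 * β, τ + 3 * β, by positivity, by linarith⟩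
  have hχ : IsTest χ := ⟨χ.contDiff, χ.hasCompactSupport⟩
  obtain ⟨L, hL⟩ := (hχ.2.fderiv ℝ).exists_bound_of_continuous
    (hχ.1.continuous_fderiv (by simp))
  have hL0 : 0 ≤ L := (norm_nonneg _).trans (hL x₀)
  set δ := β / 2 with hδ
  have hδ0 : 0 < δ := by positivity
  refine ⟨L, δ, β, hL0, hδ0, hβ0, fun k hk => ?_⟩
  set ψ := smoothDist δ x₀ with hψ
  have hψs := contDiff_smoothDist hδ0 x₀
  have hes : ContDiff ℝ ∞ fun x => Real.exp (-(k * ψ x)) :=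
    ((contDiff_const.mul hψs).neg).exp
  refine ⟨fun x => χ x * Real.exp (-(k * ψ x)), ⟨hχ.1.mul hes, hχ.2.mul_right⟩, ?_, ?_, ?_, ?_⟩
  · refine (tsupport_mul_subset_left).trans ?_
    rw [χ.tsupport_eq]
    exact Metric.closedBall_subset_ball (by change τ + 3 * β < b; rw [hβ]; linarith)
  · intro x
    exact mul_nonneg χ.nonneg (Real.exp_pos _).le
  · intro x
    have d1 : HasFDerivAt ψ (fderiv ℝ ψ x) x := (hψs.differentiable (by simp) x).hasFDerivAt
    have d2 : HasFDerivAt χ (fderiv ℝ χ x) x := (hχ.1.differentiable (by simp) x).hasFDerivAt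
    have d3 := (d2.mul ((d1.const_mul k).neg.exp)).fderiv
    change fderiv ℝ (fun x => χ x * Real.exp (-(k * ψ x))) x =
      χ x • Real.exp (-(k * ψ x)) • -(k • fderiv ℝ ψ x) +
        Real.exp (-(k * ψ x)) • fderiv ℝ χ x at d3
    rw [d3, add_comm]
    refine (norm_add_le _ _).trans (add_le_add ?_ ?_)
    · rw [norm_smul, Real.norm_eq_abs, abs_of_pos (Real.exp_pos _)]
      -- The gradient of χ lives only at distance at least τ + 2β, where the exponential is already
      -- at most exp(-k(τ + 2β)).
      by_cases hx : x ∈ Metric.ball x₀ (τ + 2 * β)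
      · have : fderiv ℝ χ x = 0 := by
          have h1 : (χ : E3 → ℝ) =ᶠ[𝓝 x] fun _ => 1 := by
            filter_upwards [Metric.isOpen_ball.mem_nhds hx] with y hy
            exact χ.one_of_mem_closedBall (Metric.ball_subset_closedBall hy)
          rw [h1.fderiv_eq]
          simp
        rw [this, norm_zero, mul_zero]
        positivity
      · rw [mul_comm]
        refine mul_le_mul (hL x) ?_ (Real.exp_pos _).le hL0
        rw [Real.exp_le_exp, neg_le_neg_iff]
        refine mul_le_mul_of_nonneg_left ?_ hk
        refine le_trans ?_ (dist_le_smoothDist δ x₀ x)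
        rw [Metric.mem_ball, not_lt, dist_eq_norm] at hx
        exact hx
    · rw [norm_smul, norm_smul, norm_neg, norm_smul, Real.norm_eq_abs, Real.norm_eq_abs,
        Real.norm_eq_abs, abs_of_nonneg hk, abs_of_pos (Real.exp_pos _),
        abs_of_nonneg (χ.nonneg)]
      have h1 := norm_fderiv_smoothDist_le hδ0 x₀ x
      have h2 : 0 ≤ χ x * Real.exp (-(k * ψ x)) := mul_nonneg χ.nonneg (Real.exp_pos _).le
      calc χ x * (Real.exp (-(k * ψ x)) * (k * ‖fderiv ℝ ψ x‖))
          = k * (χ x * Real.exp (-(k * ψ x))) * ‖fderiv ℝ ψ x‖ := by ring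
        _ ≤ k * (χ x * Real.exp (-(k * ψ x))) * 1 :=
          mul_le_mul_of_nonneg_left h1 (mul_nonneg hk h2)
        _ = _ := mul_one _
  · intro x hx
    have h1 : χ x = 1 := by
      refine χ.one_of_mem_closedBall (Metric.ball_subset_closedBall
        (Metric.ball_subset_ball ?_ hx))
      change δ ≤ τ + 2 * β
      rw [hδ]
      linarith
    change _ ≤ χ x * Real.exp (-(k * ψ x))
    rw [h1, one_mul, Real.exp_le_exp, neg_le_neg_iff]
    refine mul_le_mul_of_nonneg_left ?_ hk
    rw [Metric.mem_ball, dist_eq_norm] at hx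
    -- Within distance δ the smoothed distance is at most √2 δ, below 2δ = β.
    refine Real.sqrt_le_iff.2 ⟨hβ0.le, ?_⟩
    have : β = 2 * δ := by rw [hδ]; ring
    rw [this]
    nlinarith [norm_nonneg (x - x₀)]

/-- Gronwall's inequality in both time directions. -/
theorem le_of_abs_deriv_le {E E' : ℝ → ℝ} {K ε T : ℝ} (hK : 0 < K) (hE : ∀ s, HasDerivAt E (E' s) s)
    (h0 : E 0 = 0) (hE0 : ∀ s, 0 ≤ E s) (hE' : ∀ s, |s| ≤ |T| → |E' s| ≤ K * E s + ε)
    (hε : 0 ≤ ε) : E T ≤ ε / K * Real.exp (K * |T|) := by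
  -- The sign σ reflects time when T is negative, reducing to the forward inequality.
  obtain ⟨σ, hσ, hT⟩ : ∃ σ : ℝ, |σ| = 1 ∧ T = σ * |T| := by
    rcases le_total 0 T with h | h
    · exact ⟨1, by simp, by rw [abs_of_nonneg h, one_mul]⟩
    · exact ⟨-1, by simp, by rw [abs_of_nonpos h]; ring⟩
  have hd : ∀ s, HasDerivAt (fun s => E (σ * s)) (E' (σ * s) * σ) s := fun s => by
    have h1 : HasDerivAt (fun s => σ * s) σ s := by simpa using (hasDerivAt_id s).const_mul σ
    exact (hE (σ * s)).comp s h1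
  have h1 := norm_le_gronwallBound_of_norm_deriv_right_le (f := fun s => E (σ * s))
    (f' := fun s => E' (σ * s) * σ) (δ := 0) (K := K) (ε := ε) (a := 0) (b := |T|)
    (fun s _ => (hd s).continuousAt.continuousWithinAt) (fun s _ => (hd s).hasDerivWithinAt)
    (by simp [h0]) (fun s hs => by
      rw [norm_mul, Real.norm_eq_abs, Real.norm_eq_abs, Real.norm_eq_abs, hσ, mul_one,
        abs_of_nonneg (hE0 _)]
      exact hE' _ (by rw [abs_mul, hσ, one_mul, abs_of_nonneg hs.1]; exact hs.2.le)) |T|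
    ⟨abs_nonneg T, le_rfl⟩
  rw [Real.norm_eq_abs, ← hT, gronwallBound_of_K_ne_0 hK.ne'] at h1
  simp only [zero_mul, zero_add, sub_zero] at h1
  refine (le_abs_self _).trans (h1.trans ?_)
  exact mul_le_mul_of_nonneg_left (by linarith) (by positivity)

end

end Biot

/-! ### The energy estimate near the axis of the backward cone. -/

namespace Biot

noncomputable section

section

variable {F : Type*} [NormedAddCommGroup F] [NormedSpace ℝ F]

theorem continuous_smul_bilin {Q : E3 → F →L[ℝ] F →L[ℝ] ℝ} (hQ : Continuous Q) {g : E3 → ℝ}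
    (hg : Continuous g) : Continuous fun x => g x • Q x := hg.smul hQ

/-- The derivative of a quadratic form along a curve in `L²`. -/
theorem hasDerivAt_pairing_self {r : ℝ} {Q : E3 → F →L[ℝ] F →L[ℝ] ℝ} (hQ : Continuous Q)
    (hsymm : ∀ x a b, Q x a b = Q x b a) {w : ℝ → Lp F 2 (ballMeasure r)}
    {w' : Lp F 2 (ballMeasure r)} {t : ℝ} (hw : HasDerivAt w w' t) :
    HasDerivAt (fun s => pairing r Q hQ (w s) (w s)) (2 * pairing r Q hQ w' (w t)) t := by
  have h1 : HasDerivAt (fun s => pairing r Q hQ (w s)) (pairing r Q hQ w') t :=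
    (pairing r Q hQ).hasFDerivAt.comp_hasDerivAt t hw
  have h2 := h1.clm_apply hw
  have : pairing r Q hQ (w t) w' = pairing r Q hQ w' (w t) := by
    rw [pairing_apply, pairing_apply]
    congr 1
    funext x
    exact hsymm x _ _
  rw [this, ← two_mul] at h2
  exact h2

end

/-- The energy flux through a weight is controlled by the energy. -/
theorem abs_integral_strain_symbol_le {C : Coeffs} (hC : C.Admissible) {r : ℝ} {w : E3 → VecPair}
    {z : E3 → Strain} (hw : MemLp w 2 (ballMeasure r)) (hz : MemLp z 2 (ballMeasure r)) {g : E3 → ℝ}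
    {c : ℝ} (hc : 0 < c) (h1 : ∀ x, C.a1 x ≤ c ^ 2) (h2 : ∀ x, C.mu1 x ≤ c ^ 2) {K L : ℝ}
    (hgc : Continuous g)
    (hg : ∀ x, ‖fderiv ℝ g x‖ ≤ L + K * g x) :
    |∫ x, strainForm C x (z x) (symbolStrain (gradVec g x) (w x)) ∂ballMeasure r| ≤
      K * c * ((1 / 2) * ((∫ x, g x * massForm C x (w x) (w x) ∂ballMeasure r) +
        ∫ x, g x * strainForm C x (z x) (z x) ∂ballMeasure r)) +
      c * L * ((1 / 2) * ((∫ x, massForm C x (w x) (w x) ∂ballMeasure r) +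
        ∫ x, strainForm C x (z x) (z x) ∂ballMeasure r)) := by
  have cM := continuous_massForm hC
  have cS := continuous_strainForm hC
  have i1 := integrable_bilin (continuous_smul_bilin cM hgc) hw hw
  have i2 := integrable_bilin (continuous_smul_bilin cS hgc) hz hz
  simp only [smul_apply, smul_eq_mul] at i1 i2
  have i3 := integrable_bilin cM hw hw
  have i4 := integrable_bilin cS hz hz
  have i5 : Integrable (fun x => K * c * ((1 / 2) * (g x * massForm C x (w x) (w x) +
      g x * strainForm C x (z x) (z x)))) (ballMeasure r) :=
    ((i1.add i2).const_mul _).const_mul _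
  have i6 : Integrable (fun x => c * L * ((1 / 2) * (massForm C x (w x) (w x) +
      strainForm C x (z x) (z x)))) (ballMeasure r) :=
    ((i3.add i4).const_mul _).const_mul _
  rw [← integral_add i1 i2, ← integral_add i3 i4, ← integral_const_mul, ← integral_const_mul,
    ← integral_const_mul, ← integral_const_mul, ← integral_add i5 i6]
  rw [← Real.norm_eq_abs]
  refine norm_integral_le_of_norm_le (i5.add i6) (Eventually.of_forall fun x => ?_)
  rw [Real.norm_eq_abs]
  refine (abs_strainForm_symbol_le hC hc (h1 x) (h2 x) (gradVec g x) (w x) (z x)).trans ?_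
  rw [norm_gradVec]
  have hd : 0 ≤ massForm C x (w x) (w x) + strainForm C x (z x) (z x) :=
    add_nonneg (massForm_nonneg hC x _) (strainForm_nonneg hC x _)
  calc _ ≤ c * (L + K * g x) * ((massForm C x (w x) (w x) + strainForm C x (z x) (z x)) / 2) := by
        refine mul_le_mul_of_nonneg_right (mul_le_mul_of_nonneg_left (hg x) hc.le) (by linarith)
    _ = _ := by ring

/-- Energy estimate: a solution with vanishing data in a ball vanishes near the axis of the
backward cone over that ball. -/
theorem energy_vanish {C : Coeffs} (hC : C.Admissible) {c : ℝ} (hc : 0 < c)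
    (h1 : ∀ x, C.a1 x ≤ c ^ 2) (h2 : ∀ x, C.mu1 x ≤ c ^ 2) {r b : ℝ} {x₀ : E3}
    {w w' : ℝ → Lp VecPair 2 (ballMeasure r)} {Z Y : ℝ → Lp Strain 2 (ballMeasure r)}
    (hw : ∀ t, HasDerivAt w (w' t) t) (hZ : ∀ t, HasDerivAt Z (Y t) t)
    (hw0 : ∀ᵐ x ∂ballMeasure r, x ∈ Metric.ball x₀ b → w 0 x = 0) (hZ0 : Z 0 = 0)
    (bal : ∀ t, ∀ g : E3 → ℝ, IsTest g → tsupport g ⊆ Metric.ball x₀ b →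
      (∫ x, g x * massForm C x (w' t x) (w t x) ∂ballMeasure r) +
        ∫ x, g x * strainForm C x (Z t x) (Y t x) ∂ballMeasure r =
      -∫ x, strainForm C x (Z t x) (symbolStrain (gradVec g x) (w t x)) ∂ballMeasure r)
    {t : ℝ} (ht : c * |t| < b) :
    ∃ δ > 0, ∀ᵐ x ∂ballMeasure r, x ∈ Metric.ball x₀ δ → w t x = 0 := by
  have cM := continuous_massForm hC
  have cS := continuous_strainForm hC
  obtain ⟨L, δ, β, hL, hδ, hβ, hg⟩ := exists_weight x₀ (by positivity) ht
  refine ⟨δ, hδ, ?_⟩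
  have hwc : Continuous w := continuous_iff_continuousAt.2 fun t => (hw t).continuousAt
  have hZc : Continuous Z := continuous_iff_continuousAt.2 fun t => (hZ t).continuousAt
  set D : ℝ → ℝ := fun s => (1 / 2) * (pairing r _ cM (w s) (w s) + pairing r _ cS (Z s) (Z s))
    with hD
  have hDc : Continuous D := by
    refine continuous_const.mul (Continuous.add ?_ ?_)
    · exact ((pairing r _ cM).continuous.comp hwc).clm_apply hwc
    · exact ((pairing r _ cS).continuous.comp hZc).clm_apply hZc
  -- A bound for the unweighted energy on the whole time interval, independent of k. It multiplies
  -- the error term in the gradient bound of the weight.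
  obtain ⟨N, hN⟩ := (isCompact_Icc (a := -|t|) (b := |t|)).exists_bound_of_continuousOn
    hDc.continuousOn
  have hN0 : 0 ≤ N := (norm_nonneg _).trans (hN 0 (by simp))
  set J : ℝ := ∫ x in Metric.ball x₀ δ, massForm C x (w t x) (w t x) ∂ballMeasure r with hJ
  have iM := integrable_bilin cM (Lp.memLp (w t)) (Lp.memLp (w t))
  have mass0 : ∀ x, 0 ≤ massForm C x (w t x) (w t x) := fun x => massForm_nonneg hC x _
  -- The error exp(-k(c|t| + 2β)) beats the Gronwall factor exp(kc|t|) by exp(-2kβ), and the weight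
  -- near x₀ is at least exp(-kβ). One factor exp(-kβ) is left over.
  have bound : ∀ k : ℝ, 1 ≤ k → J ≤ 2 * (L * N) * Real.exp (-(k * β)) := by
    intro k hk
    have hk0 : 0 < k := by linarith
    obtain ⟨g, hgt, hgs, hg0, hgd, hgδ⟩ := hg k hk0.le
    have gc := hgt.1.continuous
    have cgM := continuous_smul_bilin cM gc
    have cgS := continuous_smul_bilin cS gc
    set ε := Real.exp (-(k * (c * |t| + 2 * β))) with hε
    set E : ℝ → ℝ := fun s =>
      (1 / 2) * (pairing r _ cgM (w s) (w s) + pairing r _ cgS (Z s) (Z s)) with hE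
    have hEd : ∀ s, HasDerivAt E (pairing r _ cgM (w' s) (w s) + pairing r _ cgS (Z s) (Y s)) s := by
      intro s
      have d1 := hasDerivAt_pairing_self cgM
        (fun x a b => by simp only [smul_apply, massForm_symm C x a b]) (hw s)
      have d2 := hasDerivAt_pairing_self cgS
        (fun x a b => by simp only [smul_apply, strainForm_symm C x a b]) (hZ s)
      have d3 := (d1.add d2).const_mul (1 / 2)
      have : pairing r _ cgS (Z s) (Y s) = pairing r _ cgS (Y s) (Z s) := by
        rw [pairing_apply, pairing_apply]
        congr 1
        funext x
        simp only [smul_apply, strainForm_symm C x (Z s x)]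
      have e : pairing r _ cgM (w' s) (w s) + pairing r _ cgS (Z s) (Y s) =
          1 / 2 * (2 * pairing r _ cgM (w' s) (w s) + 2 * pairing r _ cgS (Y s) (Z s)) := by
        rw [this]
        ring
      rw [e]
      exact d3
    have hE0 : ∀ s, 0 ≤ E s := by
      intro s
      refine mul_nonneg (by norm_num) (add_nonneg ?_ ?_)
      · exact integral_nonneg fun x => mul_nonneg (hg0 x) (massForm_nonneg hC x _)
      · exact integral_nonneg fun x => mul_nonneg (hg0 x) (strainForm_nonneg hC x _)
    have hEi : E 0 = 0 := by
      have e1 : pairing r _ cgM (w 0) (w 0) = 0 := by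
        refine integral_eq_zero_of_ae ?_
        filter_upwards [hw0] with x hx
        by_cases hxb : x ∈ Metric.ball x₀ b
        · simp [hx hxb]
        · have : g x = 0 := image_eq_zero_of_notMem_tsupport fun h => hxb (hgs h)
          simp [this]
      simp only [hE]
      rw [e1, hZ0]
      simp
    have hEb : ∀ s, |s| ≤ |t| →
        |pairing r _ cgM (w' s) (w s) + pairing r _ cgS (Z s) (Y s)| ≤
          k * c * E s + c * (L * ε) * N := by
      intro s hs
      have b1 := bal s g hgt hgs
      have b2 : pairing r _ cgM (w' s) (w s) + pairing r _ cgS (Z s) (Y s) =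
          -∫ x, strainForm C x (Z s x) (symbolStrain (gradVec g x) (w s x)) ∂ballMeasure r := b1
      rw [b2, abs_neg]
      refine (abs_integral_strain_symbol_le hC (Lp.memLp (w s)) (Lp.memLp (Z s)) hc h1 h2
        (L := L * ε) (K := k) gc hgd).trans ?_
      refine add_le_add (le_of_eq rfl) (mul_le_mul_of_nonneg_left ?_ (by positivity))
      exact (le_abs_self _).trans (hN s (abs_le.1 hs))
    have gron := le_of_abs_deriv_le (by positivity : 0 < k * c) hEd hEi hE0 hEb (by positivity)
    have lower : Real.exp (-(k * β)) * J ≤ 2 * E t := by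
      have ig := integrable_bilin cgM (Lp.memLp (w t)) (Lp.memLp (w t))
      have l1 : Real.exp (-(k * β)) * J ≤ pairing r _ cgM (w t) (w t) := by
        rw [hJ, ← integral_const_mul, pairing_apply]
        refine le_trans (setIntegral_mono_on (iM.const_mul _).integrableOn ig.integrableOn
          Metric.isOpen_ball.measurableSet fun x hx => ?_)
          (setIntegral_le_integral ig (Eventually.of_forall fun x => ?_))
        · exact mul_le_mul_of_nonneg_right (hgδ x hx) (mass0 x)
        · exact mul_nonneg (hg0 x) (mass0 x)
      have l2 : 0 ≤ pairing r _ cgS (Z t) (Z t) :=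
        integral_nonneg fun x => mul_nonneg (hg0 x) (strainForm_nonneg hC x _)
      simp only [hE]
      linarith
    have up : E t ≤ L * N * Real.exp (-(k * (2 * β))) := by
      refine gron.trans ?_
      have e1 : c * (L * ε) * N / (k * c) * Real.exp (k * c * |t|) =
          (L * N * (ε * Real.exp (k * c * |t|))) / k := by
        field_simp
      have e2 : ε * Real.exp (k * c * |t|) = Real.exp (-(k * (2 * β))) := by
        rw [hε, ← Real.exp_add]
        congr 1
        ring
      rw [e1, e2]
      exact div_le_self (by positivity) hk
    have e3 : Real.exp (-(k * (2 * β))) = Real.exp (-(k * β)) * Real.exp (-(k * β)) := by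
      rw [← Real.exp_add]
      congr 1
      ring
    rw [e3] at up
    refine le_of_mul_le_mul_left (a := Real.exp (-(k * β))) ?_ (Real.exp_pos _)
    linarith
  have hJ0 : J ≤ 0 := by
    have l1 : Tendsto (fun k : ℝ => 2 * (L * N) * Real.exp (-(k * β))) atTop (𝓝 0) := by
      have := (Real.tendsto_exp_neg_atTop_nhds_zero.comp
        (tendsto_id.atTop_mul_const hβ)).const_mul (2 * (L * N))
      simpa using this
    refine ge_of_tendsto l1 ?_
    filter_upwards [eventually_ge_atTop 1] with k hk using bound k hk
  have hz : ∀ᵐ x ∂(ballMeasure r).restrict (Metric.ball x₀ δ),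
      massForm C x (w t x) (w t x) = 0 := by
    have := (integral_eq_zero_iff_of_nonneg (μ := (ballMeasure r).restrict (Metric.ball x₀ δ))
      (fun x => mass0 x) iM.integrableOn).1
      (le_antisymm hJ0 (integral_nonneg fun x => mass0 x))
    exact this
  rw [ae_restrict_iff' Metric.isOpen_ball.measurableSet] at hz
  filter_upwards [hz] with x hx hxb
  exact eq_zero_of_massForm_eq_zero hC x _ (hx hxb)

end

end Biot

/-! ### Localisation outside the domain of influence, and the conclusion. -/

namespace Biot

noncomputable section

/-- Extension by zero outside the ball of radius `r`. -/
abbrev cutBall {F : Type*} [Zero F] (r : ℝ) (f : E3 → F) : E3 → F :=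
  (Metric.ball (0 : E3) r).indicator f

theorem memLp_cutBall {F : Type*} [NormedAddCommGroup F] {r : ℝ} {f : E3 → F}
    (hf : MemLp f 2 (ballMeasure r)) : MemLp (cutBall r f) 2 volume :=
  (memLp_indicator_iff_restrict Metric.isOpen_ball.measurableSet).2 hf

theorem cutBall_of_mem {F : Type*} [Zero F] {r : ℝ} {f : E3 → F} {x : E3}
    (hx : x ∈ Metric.ball (0 : E3) r) : cutBall r f x = f x :=
  Set.indicator_of_mem hx f

theorem cutBall_of_notMem {F : Type*} [Zero F] {r : ℝ} {f : E3 → F} {x : E3}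
    (hx : x ∉ Metric.ball (0 : E3) r) : cutBall r f x = 0 :=
  Set.indicator_of_notMem hx f

theorem integral_cutBall {F : Type*} [Zero F] {r : ℝ} {H : E3 → F → ℝ} (hH : ∀ x, H x 0 = 0)
    (f : E3 → F) : ∫ x, H x (cutBall r f x) = ∫ x, H x (f x) ∂ballMeasure r := by
  rw [← integral_indicator Metric.isOpen_ball.measurableSet]
  congr 1
  funext x
  by_cases hx : x ∈ Metric.ball (0 : E3) r
  · rw [Set.indicator_of_mem hx, cutBall_of_mem hx]
  · rw [Set.indicator_of_notMem hx, cutBall_of_notMem hx, hH]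

theorem integral_cutBall₂ {F₁ F₂ : Type*} [Zero F₁] [Zero F₂] {r : ℝ} {H : E3 → F₁ → F₂ → ℝ}
    (hH : ∀ x, H x 0 0 = 0) (f : E3 → F₁) (g : E3 → F₂) :
    ∫ x, H x (cutBall r f x) (cutBall r g x) = ∫ x, H x (f x) (g x) ∂ballMeasure r := by
  rw [← integral_indicator Metric.isOpen_ball.measurableSet]
  congr 1
  funext x
  by_cases hx : x ∈ Metric.ball (0 : E3) r
  · rw [Set.indicator_of_mem hx, cutBall_of_mem hx, cutBall_of_mem hx]
  · rw [Set.indicator_of_notMem hx, cutBall_of_notMem hx, cutBall_of_notMem hx, hH]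

theorem fderiv_eq_zero_of_notMem_tsupport {ϕ : E3 → ℝ} {x : E3} (hx : x ∉ tsupport ϕ) :
    fderiv ℝ ϕ x = 0 := by
  by_contra h
  exact hx (support_fderiv_subset ℝ h)

theorem integrable_fderiv_apply {ϕ : E3 → ℝ} (hϕ : IsTest ϕ) {f : E3 → E3} (hf : L2loc f) :
    Integrable fun x => fderiv ℝ ϕ x (f x) := by
  obtain ⟨r, hr⟩ := hϕ.2.isBounded.subset_ball (0 : E3)
  obtain ⟨K, hK⟩ := (hϕ.2.fderiv ℝ).exists_bound_of_continuous
    (hϕ.1.continuous_fderiv (by simp))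
  have h0 : Function.support (fun x => fderiv ℝ ϕ x (f x)) ⊆ Metric.ball 0 r := by
    intro x hx
    by_contra h
    exact hx (by
      change fderiv ℝ ϕ x (f x) = 0
      rw [fderiv_eq_zero_of_notMem_tsupport fun h' => h (hr h'), zero_apply])
  rw [← integrableOn_iff_integrable_of_support_subset h0]
  refine (((hf r).integrable one_le_two).norm.const_mul K).mono' ?_
    (Eventually.of_forall fun x => ?_)
  · exact isBoundedBilinearMap_apply.continuous.comp_aestronglyMeasurable
      ((hϕ.1.continuous_fderiv (by simp)).aestronglyMeasurable.prodMk (hf r).1)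
  · exact (ContinuousLinearMap.le_opNorm _ _).trans
      (mul_le_mul_of_nonneg_right (hK x) (norm_nonneg _))

theorem sum_apply_basis (L : E3 →L[ℝ] ℝ) (v : E3) : ∑ i, v i * L (e i) = L v := by
  conv_rhs => rw [← (EuclideanSpace.basisFun (Fin 3) ℝ).sum_repr v]
  simp [e]

theorem tsupport_smul_const_subset {ϕ : E3 → ℝ} (v : E3) :
    tsupport (fun x => ϕ x • v) ⊆ tsupport ϕ :=
  tsupport_smul_subset_left ϕ fun _ => v

/-- Outside the domain of influence, a solution is locally the stationary field determined by its
data. -/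
theorem local_vanish {C : Coeffs} (hC : C.Admissible) {us uf vs vf : ℝ → E3 → E3}
    (hu : IsSolution C us uf vs vf) {R : ℝ} (hdisp : PairSuppIn (us 0) (uf 0) {x | ‖x‖ ≤ R})
    (hvel : PairSuppIn (vs 0) (vf 0) {x | ‖x‖ ≤ R}) {c : ℝ} (hc : 0 < c)
    (h1 : ∀ x, C.a1 x ≤ c ^ 2) (h2 : ∀ x, C.mu1 x ≤ c ^ 2) {t : ℝ} {x₀ : E3}
    (hx₀ : R + c * |t| < ‖x₀‖) :
    ∃ δ > 0, ∀ᵐ x : E3, x ∈ Metric.ball x₀ δ → us t x = 0 ∧ uf t x = uf 0 x + t • vf 0 x := by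
  obtain ⟨cus, cuf, cvs, cvf, dus, duf, G, d, cG, cd, hG, hd, hS, hF⟩ := hu
  have cM := continuous_massForm hC
  have cS := continuous_strainForm hC
  set b := ‖x₀‖ - R with hb
  have hb0 : c * |t| < b := by rw [hb]; linarith
  have hbpos : 0 < b := lt_of_le_of_lt (by positivity) hb0
  set r := ‖x₀‖ + b with hr
  have hUB : Metric.ball x₀ b ⊆ Metric.ball 0 r := by
    refine Metric.ball_subset_ball' ?_
    rw [dist_zero_right, hr]
    linarith
  have hUR : Metric.ball x₀ b ⊆ {x : E3 | ‖x‖ ≤ R}ᶜ := by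
    intro x hx h
    rw [Metric.mem_ball, dist_eq_norm'] at hx
    have := norm_sub_norm_le x₀ x
    simp only [Set.mem_ofPred_eq] at h
    linarith
  -- The initial fluid fields need not vanish on the ball; only their divergences do. They are
  -- subtracted, with zero solid part, so that `w` starts from zero there and keeps the strain of
  -- `u`.
  set V0 := pairLp (0 : Lp E3 2 (ballMeasure r)) ((cvf.1 0 r).toLp (vf 0)) with hV0
  set U0 := pairLp (0 : Lp E3 2 (ballMeasure r)) ((cuf.1 0 r).toLp (uf 0)) with hU0
  set V := fun t => pairLp ((cvs.1 t r).toLp (vs t)) ((cvf.1 t r).toLp (vf t)) with hV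
  set Y := fun t => pairLp ((cG.1 t r).toLp (G t)) ((cd.1 t r).toLp (d t)) with hY
  set w := fun t => pairLp ((cus.1 t r).toLp (us t)) ((cuf.1 t r).toLp (uf t)) - U0 - t • V0
    with hw
  set Z := fun t => ∫ τ in (0 : ℝ)..t, Y τ with hZ
  have hwd : ∀ s, HasDerivAt w (V s - V0) s := by
    intro s
    have d1 := (hasDerivAt_pairLp (dus.hasDerivAt_toLp cus.1 cvs.1 r s)
      (duf.hasDerivAt_toLp cuf.1 cvf.1 r s)).sub_const U0
    have d2 := (hasDerivAt_id s).smul_const V0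
    rw [one_smul] at d2
    exact d1.sub d2
  have hYc : Continuous Y := continuous_pairLp (cG.continuous_toLp r) (cd.continuous_toLp r)
  have hZd : ∀ s, HasDerivAt Z (Y s) s := fun s =>
    (hYc.integral_hasStrictDerivAt 0 s).hasDerivAt
  have aw : ∀ s, w s =ᵐ[ballMeasure r] fun x => (us s x, uf s x - uf 0 x - s • vf 0 x) := by
    intro s
    have ez := Lp.coeFn_zero E3 2 (ballMeasure r)
    filter_upwards [Lp.coeFn_sub (pairLp ((cus.1 s r).toLp (us s)) ((cuf.1 s r).toLp (uf s)) - U0)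
      (s • V0), Lp.coeFn_sub (pairLp ((cus.1 s r).toLp (us s)) ((cuf.1 s r).toLp (uf s))) U0,
      Lp.coeFn_smul s V0, coeFn_pairLp ((cus.1 s r).toLp (us s)) ((cuf.1 s r).toLp (uf s)),
      coeFn_pairLp (0 : Lp E3 2 (ballMeasure r)) ((cuf.1 0 r).toLp (uf 0)),
      coeFn_pairLp (0 : Lp E3 2 (ballMeasure r)) ((cvf.1 0 r).toLp (vf 0)),
      (cus.1 s r).coeFn_toLp, (cuf.1 s r).coeFn_toLp, (cuf.1 0 r).coeFn_toLp,
      (cvf.1 0 r).coeFn_toLp, ez] with x e1 e2 e3 e4 e5 e6 e7 e8 e9 e10 e11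
    simp only [hw]
    rw [e1, Pi.sub_apply, e2, Pi.sub_apply, e3, Pi.smul_apply, e4, hU0, hV0, e5, e6, e7, e8, e9,
      e10, e11]
    simp
  have aY : ∀ s, Y s =ᵐ[ballMeasure r] fun x => (G s x, d s x) := by
    intro s
    filter_upwards [coeFn_pairLp ((cG.1 s r).toLp (G s)) ((cd.1 s r).toLp (d s)),
      (cG.1 s r).coeFn_toLp, (cd.1 s r).coeFn_toLp] with x e1 e2 e3
    simp only [hY]
    rw [e1, e2, e3]
  have hw0 : ∀ᵐ x ∂ballMeasure r, x ∈ Metric.ball x₀ b → w 0 x = 0 := by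
    filter_upwards [aw 0, ae_restrict_of_ae hdisp.1] with x e1 e2 hx
    rw [e1, e2 (hUR hx)]
    simp
  -- The initial solid velocity vanishes on the ball, so on test fields supported there the full
  -- initial velocity acts like its fluid part. The integrated equation thus becomes homogeneous in
  -- w' and Z.
  have hV00 : ∀ Φ : Lp VecPair 2 (ballMeasure r),
      (∀ᵐ x ∂ballMeasure r, x ∉ Metric.ball x₀ b → Φ x = 0) →
      pairing r _ cM (V 0) Φ = pairing r _ cM V0 Φ := by
    intro Φ hΦ
    rw [pairing_apply, pairing_apply]
    refine integral_congr_ae ?_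
    have ez := Lp.coeFn_zero E3 2 (ballMeasure r)
    filter_upwards [hΦ, coeFn_pairLp ((cvs.1 0 r).toLp (vs 0)) ((cvf.1 0 r).toLp (vf 0)),
      coeFn_pairLp (0 : Lp E3 2 (ballMeasure r)) ((cvf.1 0 r).toLp (vf 0)),
      (cvs.1 0 r).coeFn_toLp, ae_restrict_of_ae hvel.1, ez] with x e1 e2 e3 e4 e5 e6
    by_cases hx : x ∈ Metric.ball x₀ b
    · simp only [hV, hV0]
      rw [e2, e3, e4, e5 (hUR hx), e6]
      rfl
    · rw [e1 hx]
      simp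
  have tested : ∀ (s : ℝ) (Φ : E3 → VecPair) (Ψ : E3 → Strain), Continuous Φ → Continuous Ψ →
      (∀ x ∉ Metric.ball x₀ b, Φ x = 0) → (∀ x ∉ Metric.ball x₀ b, Ψ x = 0) →
      (∀ θ : ℝ → ℝ, IsTest θ → ∫ t, ∫ x, (deriv (deriv θ) t *
        massForm C x (us t x, uf t x) (Φ x) + θ t * strainForm C x (G t x, d t x) (Ψ x)) = 0) →
      (∫ x, massForm C x (cutBall r (V s - V0 : Lp VecPair 2 (ballMeasure r)) x) (Φ x)) +
        ∫ x, strainForm C x (cutBall r (Z s) x) (Ψ x) = 0 := by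
    intro s Φ Ψ cΦ cΨ hΦ0 hΨ0 H
    have mΦ := memLp_ball cΦ r
    have mΨ := memLp_ball cΨ r
    have k := integrated_weak hC cus cuf cvs cvf dus duf cG cd mΦ mΨ
      (fun x hx => hΦ0 x fun h => hx (hUB h)) (fun x hx => hΨ0 x fun h => hx (hUB h)) H s
    have k0 := hV00 (mΦ.toLp Φ) (by
      filter_upwards [mΦ.coeFn_toLp] with x e1 hx
      rw [e1, hΦ0 x hx])
    have k1 : pairing r _ cM (V s - V0) (mΦ.toLp Φ) + pairing r _ cS (Z s) (mΨ.toLp Ψ) = 0 := by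
      rw [map_sub, sub_apply, ← k0]
      change pairing r _ cM (V s) _ + pairing r _ cS (Z s) _ = pairing r _ cM (V 0) _ at k
      linarith
    rw [← k1, integral_cutBall (H := fun x a => massForm C x a (Φ x)) (fun x => by simp),
      integral_cutBall (H := fun x a => strainForm C x a (Ψ x)) (fun x => by simp)]
    congr 1
    · refine integral_congr_ae ?_
      filter_upwards [mΦ.coeFn_toLp] with x e1
      rw [e1]
    · refine integral_congr_ae ?_
      filter_upwards [mΨ.coeFn_toLp] with x e1
      rw [e1]
  have bal : ∀ s, ∀ g : E3 → ℝ, IsTest g → tsupport g ⊆ Metric.ball x₀ b →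
      (∫ x, g x * massForm C x ((V s - V0 : Lp VecPair 2 (ballMeasure r)) x) (w s x)
        ∂ballMeasure r) +
        ∫ x, g x * strainForm C x (Z s x) (Y s x) ∂ballMeasure r =
      -∫ x, strainForm C x (Z s x) (symbolStrain (gradVec g x) (w s x)) ∂ballMeasure r := by
    intro s g hg hgU
    rw [← integral_cutBall₂ (H := fun x a b => g x * massForm C x a b) (fun x => by simp),
      ← integral_cutBall₂ (H := fun x a b => g x * strainForm C x a b) (fun x => by simp),
      ← integral_cutBall₂ (H := fun x a b => strainForm C x a (symbolStrain (gradVec g x) b))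
        (fun x => by simp)]
    refine energy_balance hC Metric.isOpen_ball (memLp_cutBall (Lp.memLp (w s)))
      (memLp_cutBall (Lp.memLp _)) (memLp_cutBall (Lp.memLp (Z s)))
      (memLp_cutBall (Lp.memLp (Y s))) (r := r) (fun x hx => cutBall_of_notMem hx)
      (fun x hx => cutBall_of_notMem hx) ?_ ?_ ?_ ?_ hg hgU
    · intro i ϕ hϕ hϕU
      have ht := hϕ.smul_const (e i)
      have hts := (tsupport_smul_const_subset (ϕ := ϕ) (e i)).trans hϕU
      refine tested s (fun x => (ϕ x • e i, 0)) (fun x => (pd (fun x => ϕ x • e i) x, 0))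
        (ht.1.continuous.prodMk continuous_const)
        ((continuous_pd ht).prodMk continuous_const) ?_ ?_ fun θ hθ => weak_solid hS ht hθ
      · intro x hx
        have := image_eq_zero_of_notMem_tsupport fun h => hx (hϕU h)
        simp [this]
      · intro x hx
        rw [pd_eq_zero fun h => hx (hts h)]
        rfl
    · intro i ϕ hϕ hϕU
      have ht := hϕ.smul_const (e i)
      have hts := (tsupport_smul_const_subset (ϕ := ϕ) (e i)).trans hϕU
      refine tested s (fun x => (0, ϕ x • e i)) (fun x => (0, tr3 (pd (fun x => ϕ x • e i) x)))
        (continuous_const.prodMk ht.1.continuous)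
        (continuous_const.prodMk (continuous_finsetSum _ fun k _ =>
          (continuous_apply_apply k k).comp (continuous_pd ht))) ?_ ?_
        fun θ hθ => weak_fluid hF ht hθ
      · intro x hx
        have := image_eq_zero_of_notMem_tsupport fun h => hx (hϕU h)
        simp [this]
      · intro x hx
        rw [pd_eq_zero fun h => hx (hts h)]
        simp [tr3]
    · intro i j ϕ hϕ hϕU
      have hϕB : ∀ x ∉ Metric.ball (0 : E3) r, x ∉ tsupport ϕ := fun x hx h => hx (hUB (hϕU h))
      rw [integral_cutBall (H := fun x (a : VecPair) => a.1 i * fderiv ℝ ϕ x (e j))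
          (fun x => by simp),
        integral_cutBall (H := fun x (a : Strain) => a.1 i j * ϕ x) (fun x => by simp)]
      have e1 : ∫ x, (w s x).1 i * fderiv ℝ ϕ x (e j) ∂ballMeasure r =
          ∫ x, us s x i * fderiv ℝ ϕ x (e j) := by
        rw [← setIntegral_ball_eq (r := r)]
        · refine integral_congr_ae ?_
          filter_upwards [aw s] with x e1
          rw [e1]
        · intro x hx
          simp [fderiv_eq_zero_of_notMem_tsupport (hϕB x hx)]
      have e2 : ∫ x, (Y s x).1 i j * ϕ x ∂ballMeasure r = ∫ x, G s x i j * ϕ x := by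
        rw [← setIntegral_ball_eq (r := r)]
        · refine integral_congr_ae ?_
          filter_upwards [aY s] with x e1
          rw [e1]
        · intro x hx
          simp [image_eq_zero_of_notMem_tsupport (hϕB x hx)]
      rw [e1, e2]
      exact hG s i j ϕ hϕ
    · intro ϕ hϕ hϕU
      have hϕB : ∀ x ∉ Metric.ball (0 : E3) r, x ∉ tsupport ϕ := fun x hx h => hx (hUB (hϕU h))
      have mw := memLp_cutBall (Lp.memLp (w s))
      have mi : ∀ i, Integrable fun x => (cutBall r (w s) x).2 i * fderiv ℝ ϕ x (e i) := fun i =>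
        (memLp_coord (memLp_snd mw) i).integrable_mul (q := 2)
          ((hϕ.fderiv_apply (e i)).1.continuous.memLp_of_hasCompactSupport
            (hϕ.fderiv_apply (e i)).2)
      rw [← integral_finsetSum _ fun i _ => mi i]
      simp only [sum_apply_basis]
      rw [integral_cutBall (H := fun x (a : VecPair) => fderiv ℝ ϕ x a.2) (fun x => by simp),
        integral_cutBall (H := fun x (a : Strain) => a.2 * ϕ x) (fun x => by simp)]
      have e1 : ∫ x, fderiv ℝ ϕ x (w s x).2 ∂ballMeasure r =
          ∫ x, (fderiv ℝ ϕ x (uf s x) - fderiv ℝ ϕ x (uf 0 x) - s * fderiv ℝ ϕ x (vf 0 x)) := by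
        rw [← setIntegral_ball_eq (r := r)]
        · refine integral_congr_ae ?_
          filter_upwards [aw s] with x e1
          rw [e1]
          simp
        · intro x hx
          simp [fderiv_eq_zero_of_notMem_tsupport (hϕB x hx)]
      have e2 : ∫ x, (Y s x).2 * ϕ x ∂ballMeasure r = ∫ x, d s x * ϕ x := by
        rw [← setIntegral_ball_eq (r := r)]
        · refine integral_congr_ae ?_
          filter_upwards [aY s] with x e1
          rw [e1]
        · intro x hx
          simp [image_eq_zero_of_notMem_tsupport (hϕB x hx)]
      have i1 := integrable_fderiv_apply hϕ (cuf.1 s)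
      have i2 := integrable_fderiv_apply hϕ (cuf.1 0)
      have i3 := integrable_fderiv_apply hϕ (cvf.1 0)
      have i12 : Integrable fun x => fderiv ℝ ϕ x (uf s x) - fderiv ℝ ϕ x (uf 0 x) := i1.sub i2
      -- The subtracted fluid fields contribute nothing, by the conditions on the divergences of the
      -- data.
      rw [e1, e2, integral_sub i12 (i3.const_mul s), integral_sub i1 i2,
        integral_const_mul, hd s ϕ hϕ, hdisp.2 ϕ hϕ (hϕU.trans hUR), hvel.2 ϕ hϕ (hϕU.trans hUR)]
      ring
  obtain ⟨δ, hδ, hv⟩ := energy_vanish hC hc h1 h2 hwd hZd hw0 (by simp [hZ]) bal hb0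
  -- The radius is kept below b so that the small ball lies inside the ball of radius `r`, where the
  -- almost-everywhere statement is available.
  refine ⟨min δ b, lt_min hδ hbpos, ?_⟩
  have h3 : ∀ᵐ x ∂ballMeasure r, x ∈ Metric.ball x₀ δ →
      us t x = 0 ∧ uf t x = uf 0 x + t • vf 0 x := by
    filter_upwards [hv, aw t] with x e1 e2 hx
    have e3 := e1 hx
    rw [e2, Prod.mk_eq_zero] at e3
    refine ⟨e3.1, ?_⟩
    rw [sub_sub, sub_eq_zero] at e3
    exact e3.2
  rw [ae_restrict_iff' Metric.isOpen_ball.measurableSet] at h3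
  filter_upwards [h3] with x e1 hx
  exact e1 (hUB (Metric.ball_subset_ball (min_le_right _ _) hx))
    (Metric.ball_subset_ball (min_le_left _ _) hx)

/-- Finite speed of propagation with any speed bounding the characteristic speeds. -/
theorem finite_speed {C : Coeffs} (hC : C.Admissible) {us uf vs vf : ℝ → E3 → E3}
    (hu : IsSolution C us uf vs vf) {R : ℝ} (hdisp : PairSuppIn (us 0) (uf 0) {x | ‖x‖ ≤ R})
    (hvel : PairSuppIn (vs 0) (vf 0) {x | ‖x‖ ≤ R}) {c : ℝ} (hc : 0 < c)
    (h1 : ∀ x, C.a1 x ≤ c ^ 2) (h2 : ∀ x, C.mu1 x ≤ c ^ 2) (t : ℝ) :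
    PairSuppIn (us t) (uf t) {x | ‖x‖ ≤ R + c * |t|} := by
  have hae : ∀ᵐ x : E3, x ∉ {x : E3 | ‖x‖ ≤ R + c * |t|} →
      us t x = 0 ∧ uf t x = uf 0 x + t • vf 0 x := by
    rw [ae_iff]
    -- Each point of the exceptional set has a neighbourhood meeting it in a null set; by second
    -- countability the whole set is null.
    refine measure_null_of_locally_null _ fun x hx => ?_
    simp only [Set.mem_ofPred_eq, Classical.not_imp, not_le] at hx
    obtain ⟨δ, hδ, h⟩ := local_vanish hC hu hdisp hvel hc h1 h2 hx.1
    refine ⟨_, inter_mem_nhdsWithin _ (Metric.ball_mem_nhds x hδ), ?_⟩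
    rw [ae_iff] at h
    refine measure_mono_null ?_ h
    rintro y ⟨hy, hyb⟩
    simp only [Set.mem_ofPred_eq, Classical.not_imp] at hy ⊢
    exact ⟨hyb, hy.2⟩
  refine ⟨hae.mono fun x h hx => (h hx).1, fun φ hφ hs => ?_⟩
  have hsR : tsupport φ ⊆ {x : E3 | ‖x‖ ≤ R}ᶜ := by
    refine hs.trans (Set.compl_subset_compl.2 fun x hx => ?_)
    have : 0 ≤ c * |t| := by positivity
    simp only [Set.mem_ofPred_eq] at hx ⊢
    linarith
  -- On the support of φ the fluid displacement is affine in t with the initial fields as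
  -- coefficients, and both have zero divergence there.
  have e1 : ∫ x, fderiv ℝ φ x (uf t x) =
      ∫ x, (fderiv ℝ φ x (uf 0 x) + t * fderiv ℝ φ x (vf 0 x)) := by
    refine integral_congr_ae ?_
    filter_upwards [hae] with x hx
    by_cases hxs : x ∈ tsupport φ
    · rw [(hx (hs hxs)).2]
      simp
    · simp [fderiv_eq_zero_of_notMem_tsupport hxs]
  rw [e1, integral_add (integrable_fderiv_apply hφ (hu.cont_uf.1 0))
    ((integrable_fderiv_apply hφ (hu.cont_vf.1 0)).const_mul t), integral_const_mul,
    hdisp.2 φ hφ hsR, hvel.2 φ hφ hsR]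
  simp

/-- The entries 0 and 2 of `waveCoeff` are a₁ and μ₁; the smaller eigenvalue a₂ is not needed. -/
theorem le_sq_of_cmax {C : Coeffs} (hC : C.Admissible) {c : ℝ} (h : C.cmax = (c : EReal)) :
    0 < c ∧ (∀ x, C.a1 x ≤ c ^ 2) ∧ ∀ x, C.mu1 x ≤ c ^ 2 := by
  have hs : ∀ x k, √(C.waveCoeff x k) ≤ c := fun x k => by
    have := C.sqrt_waveCoeff_le_cmax hC x k
    rw [h, EReal.coe_le_coe_iff] at this
    exact this
  have hc : 0 < c := (Real.sqrt_pos.2 (hC.waveCoeff_pos 0 0)).trans_le (hs 0 0)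
  have hle : ∀ x k, C.waveCoeff x k ≤ c ^ 2 := fun x k => (Real.sqrt_le_left hc.le).1 (hs x k)
  exact ⟨hc, fun x => hle x 0, fun x => hle x 2⟩

end

end Biot

theorem corollary4p2 (C : Biot.Coeffs) (hC : C.Admissible)
    (us uf vs vf : ℝ → Biot.E3 → Biot.E3) (hu : Biot.IsSolution C us uf vs vf) (R : ℝ)
    (hdisp : Biot.PairSuppIn (us 0) (uf 0) {x | ‖x‖ ≤ R})
    (hvel : Biot.PairSuppIn (vs 0) (vf 0) {x | ‖x‖ ≤ R}) (t : ℝ) :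
    Biot.PairSuppIn (us t) (uf t)
      {x | ((‖x‖ : ℝ) : EReal) ≤ (R : EReal) + C.cmax * ((|t| : ℝ) : EReal)} := by
  have hlow := C.sqrt_waveCoeff_le_cmax hC 0 0
  induction hcm : C.cmax using EReal.rec with
  | bot =>
    rw [hcm] at hlow
    exact absurd hlow (by simp)
  | coe c =>
    obtain ⟨hc, h1, h2⟩ := Biot.le_sq_of_cmax hC hcm
    have := Biot.finite_speed hC hu hdisp hvel hc h1 h2 t
    convert this using 3 with x
    rw [← EReal.coe_mul, ← EReal.coe_add, EReal.coe_le_coe_iff]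
  | top =>
    -- In `EReal`, ⊤ * 0 = 0, so infinite speed at time 0 gives back the condition on the data; at
    -- any other time the set is the whole space.
    rcases eq_or_ne t 0 with rfl | ht
    · simpa using hdisp
    · have htop : (⊤ : EReal) * ((|t| : ℝ) : EReal) = ⊤ :=
        EReal.top_mul_coe_of_pos (abs_pos.2 ht)
      simp only [htop, EReal.coe_add_top, le_top, Set.ofPred_true]
      refine ⟨by simp, fun φ _ hs => ?_⟩
      rw [Set.compl_univ, Set.subset_empty_iff, tsupport_eq_empty_iff] at hs
      simp [hs]
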